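/- For each $p\ge 1$ let $\mathbf W=\mathbf W_p$ be a real $p\times p$ matrix with $i$-th row $\mathbf w_i^T$, let $\boldsymbol\lambda_0,\boldsymbol\lambda_1,\boldsymbol\lambda_2\in\mathbb R^p$ (all may depend on $p$), write $D(\boldsymbol\lambda)=\mathrm{diag}(\lambda_1,\dots,\lambda_p)$, $\mathbf S(\boldsymbol\lambda_0)=\mathbf I-D(\boldsymbol\lambda_0)\mathbf W$, and, when $\mathbf S(\boldsymbol\lambda_0)$ is invertible, $\mathbf A=\mathbf S^{-1}(\boldsymbol\lambda_0)\,(D(\boldsymbol\lambda_1)+D(\boldsymbol\lambda_2)\mathbf W)$. For a matrix $\mathbf H=(h_{ij})$ let $|\mathbf H|=(|h_{ij}|)$. Let $(\varepsilon_{i,t})_{i\ge 1,\,t\in\mathbb Z}$ be an array of real random variables on a probability space, $\boldsymbol\varepsilon_t=(\varepsilon_{1,t},\dots,\varepsilon_{p,t})^T$, and for each $p$ let $(\mathbf y_t)_{t\in\mathbb Z}$ be a process of random vectors in $\mathbb R^p$ that is bounded in probability (for every $\delta>0$ there is $K$ with $\sup_t P(\|\mathbf y_t\|>K)\le\delta$;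 in particular this covers the stationary solution) and satisfies, almost surely for every $t\in\mathbb Z$, $$\mathbf y_t=D(\boldsymbol\lambda_0)\mathbf W\mathbf y_t+D(\boldsymbol\lambda_1)\mathbf y_{t-1}+D(\boldsymbol\lambda_2)\mathbf W\mathbf y_{t-1}+\boldsymbol\varepsilon_t .$$ Assume: (A1) $\mathbf W$ has zero main diagonal and $\mathbf S(\boldsymbol\lambda_0)$ is invertible, for every $p$. (B1) The $\varepsilon_{i,t}$ are i.i.d. across $i$ and $t$ with $\mathrm E\,\varepsilon_{i,t}=0$, $\mathrm{Var}(\varepsilon_{i,t})=\sigma_0^2$ and $\mathrm E|\varepsilon_{i,t}|^{8}<\infty$, and their distribution has a density with respect to Lebesgue measure. (B2) The row and column sums of $|\mathbf W|$ and $|\mathbf S^{-1}(\boldsymbol\lambda_0)|$ are bounded uniformly in $p$. (B3) The series $\sum_{j=0}^\infty|\mathbf A^j|$ converges for every $p$, and the row and column sums of its sum are bounded uniformly in $p$. Put $\boldsymbol\Sigma_k=\mathrm{Cov}(\mathbf y_{t+k},\mathbf y_t)$, let $\mathbf e_i$ be the $i$-th unit vector, and for each $p$ let $$\alpha(k)=\sup\{|P(A)P(B)-P(A\cap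 B)|:\ A\in\sigma(\mathbf y_t,\,t\le 0),\ B\in\sigma(\mathbf y_t,\,t\ge k)\}.$$ Then: (a) $\mathrm{Cov}(\mathbf y_{t-1},\boldsymbol\varepsilon_t)=0$ for every $p$ and $t$; (b) for every $p$, the process $(\mathbf y_t)$ is strictly stationary and $\alpha$-mixing (that is, $\alpha(k)\to0$), and $\sum_{k=1}^\infty\alpha(k)^{1/2}<\infty$; (c) the moments $$\mathrm E|\mathbf w_i^T\boldsymbol\Sigma_0\mathbf y_t|^{8},\quad \mathrm E|\mathbf w_i^T\boldsymbol\Sigma_1\mathbf y_t|^{8},\quad \mathrm E|\mathbf e_i^T\boldsymbol\Sigma_0\mathbf y_t|^{8},\quad \mathrm E|\mathbf w_i^T\mathbf y_t|^{8},\quad \mathrm E|\mathbf e_i^T\mathbf y_t|^{8}$$ and the quantities $\mathbf w_i^T\boldsymbol\Sigma_1\boldsymbol\Sigma_1^T\mathbf w_i$, $\mathbf e_i^T\boldsymbol\Sigma_0\boldsymbol\Sigma_0\mathbf e_i$, $\mathbf w_i^T\boldsymbol\Sigma_0\boldsymbol\Sigma_0\mathbf w_i$ are bounded uniformly in $p\ge1$,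 $1\le i\le p$ and $t\in\mathbb Z$. -/

import Mathlib

open MeasureTheory ProbabilityTheory Filter Topology
open scoped Matrix

noncomputable section

/-- The parameters of the spatial dynamic panel model at `p` locations: the weight matrix `W` and
the location-specific coefficient vectors `lam0`, `lam1`, `lam2`. -/
structure SpatialModel (p : ℕ) where
  W : Matrix (Fin p) (Fin p) ℝ
  lam0 : Fin p → ℝ
  lam1 : Fin p → ℝ
  lam2 : Fin p → ℝ

namespace SpatialModel

variable {p : ℕ}

/-- `S(λ₀) = I - D(λ₀) W`. -/
def S (M : SpatialModel p) : Matrix (Fin p) (Fin p) ℝ :=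
  1 - Matrix.diagonal M.lam0 * M.W

/-- `A = S(λ₀)⁻¹ (D(λ₁) + D(λ₂) W)`. -/
def A (M : SpatialModel p) : Matrix (Fin p) (Fin p) ℝ :=
  M.S⁻¹ * (Matrix.diagonal M.lam1 + Matrix.diagonal M.lam2 * M.W)

end SpatialModel

variable {Ω : Type*} [MeasurableSpace Ω]

/-- The process `y` solves
`y_t = D(λ₀) W y_t + D(λ₁) y_{t-1} + D(λ₂) W y_{t-1} + e_t` almost surely, for every `t ∈ ℤ`. -/
def SolvesModel {p : ℕ} (μ : Measure Ω) (M : SpatialModel p) (e y : ℤ → Ω → Fin p → ℝ) : Prop :=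
  ∀ t : ℤ, ∀ᵐ ω ∂μ,
    y t ω = Matrix.diagonal M.lam0 *ᵥ (M.W *ᵥ y t ω) + Matrix.diagonal M.lam1 *ᵥ y (t - 1) ω
      + Matrix.diagonal M.lam2 *ᵥ (M.W *ᵥ y (t - 1) ω) + e t ω

/-- Boundedness in probability (tightness) of a vector-valued process indexed by `ℤ`. -/
def BoundedInProbability {p : ℕ} (μ : Measure Ω) (y : ℤ → Ω → Fin p → ℝ) : Prop :=
  ∀ δ : ℝ, 0 < δ → ∃ K : ℝ, ∀ t : ℤ, μ.real {ω | K < ‖y t ω‖} ≤ δ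

/-- The disturbance vector at `p` locations: the first `p` entries of the error array. -/
def errorVec (ε : ℕ → ℤ → Ω → ℝ) (p : ℕ) : ℤ → Ω → Fin p → ℝ :=
  fun t ω i => ε i t ω

/-- Strict stationarity: the law of the whole path (for the product σ-algebra, so equivalently all
finite-dimensional laws) is invariant under time shifts. -/
def StrictlyStationary {p : ℕ} (μ : Measure Ω) (y : ℤ → Ω → Fin p → ℝ) : Prop :=
  ∀ h : ℤ, IdentDistrib (fun ω (t : ℤ) => y (t + h) ω) (fun ω (t : ℤ) => y t ω) μ μ

/-- The σ-algebra generated by `y_t`, `t ∈ I`. -/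
abbrev sigmaGen {p : ℕ} (y : ℤ → Ω → Fin p → ℝ) (I : Set ℤ) : MeasurableSpace Ω :=
  ⨆ t ∈ I, MeasurableSpace.comap (y t) inferInstance

/-- The α-mixing coefficient
`α(k) = sup { |P(A)P(B) - P(A ∩ B)| : A ∈ σ(y_t, t ≤ 0), B ∈ σ(y_t, t ≥ k) }`. -/
def alphaCoef {p : ℕ} (μ : Measure Ω) (y : ℤ → Ω → Fin p → ℝ) (k : ℕ) : ℝ :=
  sSup {r : ℝ | ∃ A B : Set Ω,
    MeasurableSet[sigmaGen y (Set.Iic 0)] A ∧ MeasurableSet[sigmaGen y (Set.Ici (k : ℤ))] B ∧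
    r = |μ.real A * μ.real B - μ.real (A ∩ B)|}

/-- `Σ_k = Cov(y_{t+k}, y_t)`, evaluated at `t = 0` (for a strictly stationary process the choice
of `t` is immaterial). -/
def autoCov {p : ℕ} (μ : Measure Ω) (y : ℤ → Ω → Fin p → ℝ) (k : ℕ) :
    Matrix (Fin p) (Fin p) ℝ :=
  Matrix.of fun i j => cov[fun ω => y (k : ℤ) ω i, fun ω => y 0 ω j; μ]

/-- The matrix `V_i`; here `w` is the `i`-th row of `W` and `e` the `i`-th unit vector. -/
def matV {p : ℕ} (μ : Measure Ω) (M : SpatialModel p) (y : ℤ → Ω → Fin p → ℝ) (i : Fin p) :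
    Matrix (Fin 3) (Fin 3) ℝ :=
  let S0 := autoCov μ y 0
  let S1 := autoCov μ y 1
  let w : Fin p → ℝ := M.W i
  let e : Fin p → ℝ := Pi.single i 1
  !![w ⬝ᵥ ((S1 * S1ᵀ) *ᵥ w), w ⬝ᵥ ((S1 * S0) *ᵥ e), w ⬝ᵥ ((S1 * S0) *ᵥ w);
     w ⬝ᵥ ((S1 * S0) *ᵥ e), e ⬝ᵥ ((S0 * S0) *ᵥ e), e ⬝ᵥ ((S0 * S0) *ᵥ w);
     w ⬝ᵥ ((S1 * S0) *ᵥ w), e ⬝ᵥ ((S0 * S0) *ᵥ w), w ⬝ᵥ ((S0 * S0) *ᵥ w)]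

/-- The row and column sums of `|H_p|` are bounded uniformly in `p`. -/
def BoundedRowColSums (H : ∀ p : ℕ, Matrix (Fin p) (Fin p) ℝ) : Prop :=
  ∃ C : ℝ, ∀ p : ℕ, (∀ i, ∑ j, |H p i j| ≤ C) ∧ (∀ j, ∑ i, |H p i j| ≤ C)

/-- The weight matrix has zero main diagonal and `S(λ₀)` is invertible, for every `p`. -/
structure ConditionA1 (M : ∀ p : ℕ, SpatialModel p) : Prop where
  diag_zero : ∀ p i, (M p).W i i = 0
  invertible : ∀ p, IsUnit (M p).S

/-- The errors are i.i.d. over locations and times, with mean zero, variance `σ₀²`, a finite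
absolute moment of order `4 + γ`, and a Lebesgue density. -/
structure ConditionB1 (μ : Measure Ω) (ε : ℕ → ℤ → Ω → ℝ) (σ₀ γ : ℝ) : Prop where
  measurable : ∀ i t, Measurable (ε i t)
  indep : iIndepFun (fun it : ℕ × ℤ => ε it.1 it.2) μ
  identDistrib : ∀ i t j s, IdentDistrib (ε i t) (ε j s) μ μ
  mean_zero : ∀ i t, μ[ε i t] = 0
  variance_eq : ∀ i t, Var[ε i t; μ] = σ₀ ^ 2
  moment : ∀ i t, ∫⁻ ω, ‖ε i t ω‖ₑ ^ (4 + γ) ∂μ < ⊤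
  density : ∀ i t, HasPDF (ε i t) μ volume

/-- The row and column sums of `|W|` and `|S(λ₀)⁻¹|` are bounded uniformly in `p`. -/
structure ConditionB2 (M : ∀ p : ℕ, SpatialModel p) : Prop where
  weight : BoundedRowColSums fun p => (M p).W
  inverse : BoundedRowColSums fun p => (M p).S⁻¹

/-- The series `∑_j |A^j|` converges for every `p`, and the row and column sums of its sum are
bounded uniformly in `p`. -/
structure ConditionB3 (M : ∀ p : ℕ, SpatialModel p) : Prop where
  summable : ∀ p i j, Summable fun n : ℕ => |((M p).A ^ n) i j|
  bounded : BoundedRowColSums fun p => Matrix.of fun i j => ∑' n : ℕ, |((M p).A ^ n) i j|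

/-- The moments `E |X_{p,i,t}|^r` are bounded uniformly in the dimension `p`, the location `i` and
the time `t`. -/
def UniformMoment (μ : Measure Ω) (r : ℝ) (X : ∀ p : ℕ, Fin p → ℤ → Ω → ℝ) : Prop :=
  ∃ C : ℝ, ∀ (p : ℕ) (i : Fin p) (t : ℤ), ∫⁻ ω, ‖X p i t ω‖ₑ ^ r ∂μ ≤ ENNReal.ofReal C

/-- The regularity condition on the processes `y^{(p)}` with the constant `γ`. -/
structure ConditionA2 (μ : Measure Ω) (M : ∀ p : ℕ, SpatialModel p) (ε : ℕ → ℤ → Ω → ℝ)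
    (y : ∀ p : ℕ, ℤ → Ω → Fin p → ℝ) (γ : ℝ) : Prop where
  /-- (a) `Cov(y_{t-1}, ε_t) = 0`. -/
  uncorrelated : ∀ p (t : ℤ) (i j : Fin p),
    cov[fun ω => y p (t - 1) ω i, fun ω => errorVec ε p t ω j; μ] = 0
  /-- (b) `γ` is positive, the process is strictly stationary and α-mixing, and
  `∑_{k ≥ 1} α(k)^{γ/(4+γ)}` is finite. -/
  gamma_pos : 0 < γ
  stationary : ∀ p, StrictlyStationary μ (y p)
  mixing : ∀ p, Tendsto (alphaCoef μ (y p)) atTop (𝓝 0)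
  summable_alpha : ∀ p, Summable fun k : ℕ => alphaCoef μ (y p) (k + 1) ^ (γ / (4 + γ))
  /-- (c) uniform moment bounds for the linear forms `w_iᵀΣ₀y_t`, `w_iᵀΣ₁y_t`, `e_iᵀΣ₀y_t`,
  `w_iᵀy_t`, `e_iᵀy_t`, and uniform bounds for the diagonal elements of `V_i`. -/
  moment_w_S0 : UniformMoment μ (4 + γ) fun p i t ω =>
    (M p).W i ⬝ᵥ (autoCov μ (y p) 0 *ᵥ y p t ω)
  moment_w_S1 : UniformMoment μ (4 + γ) fun p i t ω =>
    (M p).W i ⬝ᵥ (autoCov μ (y p) 1 *ᵥ y p t ω)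
  moment_e_S0 : UniformMoment μ (4 + γ) fun p i t ω =>
    (Pi.single i 1 : Fin p → ℝ) ⬝ᵥ (autoCov μ (y p) 0 *ᵥ y p t ω)
  moment_w : UniformMoment μ (4 + γ) fun p i t ω => (M p).W i ⬝ᵥ y p t ω
  moment_e : UniformMoment μ (4 + γ) fun p i t ω => (Pi.single i 1 : Fin p → ℝ) ⬝ᵥ y p t ω
  diag_V : ∃ C : ℝ, ∀ (p : ℕ) (i : Fin p) (k : Fin 3), |matV μ (M p) (y p) i k k| ≤ C

end

/-! Multiplying the model by `S⁻¹` gives the reduced form `y_t = A y_{t-1} + S⁻¹ ε_t`, a vector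
autoregression with i.i.d. innovations that have a density and with summable `‖A^n‖`. Iterating `n`
times leaves the remainder `A^n y_{t-n}`, which tends to zero in probability by tightness, so `y_t`
is almost surely `∑_j A^j S⁻¹ ε_{t-j}` (`ae_tendsto_movingAverage`). Strict stationarity and the
independence of `y_{t-1}` and `ε_t` follow from this representation.

Mixing rests on `exists_geometric_coupling`: for `g` with values in `[0, 1]`, the function `x ↦ E
g(x_k)` of the starting point oscillates by at most `ρ^k (1 + K‖v‖)` under translation by `v`. Two
starting points that are far apart are driven by the same innovation and approach each other,
because `A` contracts an equivalent norm. Once they are close, one step with the density of the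
innovation makes the two laws overlap, since translation is continuous in `L¹`. By the Markov
property, an event `B` of the future from time `k` on has conditional probability `h(y_0)` given the
past, with `h` flat in this sense. Hence `P(B)` is close to `h(0)` and `P(A ∩ B)` to `P(A) h(0)`,
with an error of order `ρ^k (1 + K E‖y_0‖)`. Thus `α(k)` decays geometrically, and every positive
power of it is summable.

For the uniform bounds, Minkowski's inequality in the moving average controls the eighth moments of
the components through the row sums of `∑_j |A^j|` and `|S⁻¹|` (`SpatialModel.eLpNorm_le`). The
Lyapunov equation for `Σ₀` gives `|Σ₀| ≤ σ₀² (∑|A^j|) |S⁻¹ S⁻ᵀ| (∑|A^j|)ᵀ` entrywise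
(`abs_le_of_lyapunov`), and `Σ₁ = A Σ₀`. Matrix families with uniformly bounded row and column sums
are closed under products and transposes, so all matrices in (c) belong to this class. -/

section Autoregression

variable {Ω : Type*} [MeasurableSpace Ω]

/-! ### Loss of memory of transition operators. -/

/-- Translation is continuous in `L¹`. -/
theorem exists_integral_abs_translate_sub_le {E : Type*} [NormedAddCommGroup E] [NormedSpace ℝ E]
    [FiniteDimensional ℝ E] [MeasurableSpace E] [BorelSpace E] (μ : Measure E)
    [μ.IsAddHaarMeasure] {f : E → ℝ} (hf : Integrable f μ) {r : ℝ} (hr : 0 < r) :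
    ∃ δ > 0, ∀ w : E, ‖w‖ ≤ δ → ∫ z, |f (z - w) - f z| ∂μ ≤ r := by
  have : Fact ((1 : ENNReal) ≤ 1) := ⟨le_rfl⟩
  have : Fact ((1 : ENNReal) ≠ ⊤) := ⟨ENNReal.one_ne_top⟩
  have hm : MemLp f 1 μ := memLp_one_iff_integrable.2 hf
  have hc : Continuous fun w : E => DomAddAct.mk (-w) +ᵥ hm.toLp f :=
    ((DomAddAct.continuous_mk.comp continuous_neg)).vadd continuous_const
  have h0 := (hc.tendsto 0)
  rw [Metric.tendsto_nhds_nhds] at h0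
  obtain ⟨δ, hδ, h⟩ := h0 r hr
  refine ⟨δ / 2, by positivity, fun w hw => ?_⟩
  have h1 := h (x := w) (by rw [dist_zero_right]; linarith)
  have h2 : DomAddAct.mk (-(0 : E)) +ᵥ hm.toLp f = hm.toLp f := by
    rw [neg_zero]; simp
  rw [h2, dist_eq_norm, DomAddAct.mk_vadd_toLp, ← MemLp.toLp_sub, Lp.norm_toLp,
    eLpNorm_one_eq_lintegral_enorm] at h1
  refine le_trans (le_of_eq ?_) h1.le
  rw [← integral_norm_eq_lintegral_enorm]
  · refine integral_congr_ae (ae_of_all _ fun z => ?_)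
    simp [sub_eq_neg_add]
  · exact ((hm.comp_measurePreserving (measurePreserving_vadd (-w) μ)).sub hm).1

/-- The transition operator `g ↦ (x ↦ E g(T x + η))` of the autoregression `x ↦ T x + η`, where `ν`
is the law of the innovation `η`. -/
noncomputable def transitionOp {E : Type*} [NormedAddCommGroup E] [NormedSpace ℝ E]
    [MeasurableSpace E] (T : E →L[ℝ] E) (ν : Measure E) (g : E → ℝ) (x : E) : ℝ :=
  ∫ z, g (T x + z) ∂ν

section Transition

variable {E : Type*} [NormedAddCommGroup E] [NormedSpace ℝ E] [FiniteDimensional ℝ E]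
  [MeasurableSpace E] [BorelSpace E] {T : E →L[ℝ] E} {ν : Measure E} {g : E → ℝ}

theorem measurable_transitionOp [SFinite ν] (hg : Measurable g) :
    Measurable (transitionOp T ν g) := by
  have h : Measurable fun q : E × E => g (T q.1 + q.2) :=
    hg.comp ((T.measurable.comp measurable_fst).add measurable_snd)
  exact (h.stronglyMeasurable.integral_prod_right (ν := ν)).measurable

theorem integrable_comp_of_mem_Icc {α : Type*} [MeasurableSpace α] {κ : Measure α}
    [IsFiniteMeasure κ] {u : α → ℝ} (hu : Measurable u) (hu1 : ∀ x, u x ∈ Set.Icc (0 : ℝ) 1) :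
    Integrable u κ :=
  Integrable.of_bound hu.aestronglyMeasurable 1
    (ae_of_all _ fun x => by rw [Real.norm_eq_abs, abs_of_nonneg (hu1 x).1]; exact (hu1 x).2)

theorem integral_mem_Icc {α : Type*} [MeasurableSpace α] {κ : Measure α}
    [IsProbabilityMeasure κ] {u : α → ℝ} (hu : Measurable u)
    (hu1 : ∀ x, u x ∈ Set.Icc (0 : ℝ) 1) : ∫ x, u x ∂κ ∈ Set.Icc (0 : ℝ) 1 := by
  refine ⟨integral_nonneg fun x => (hu1 x).1, ?_⟩
  calc ∫ x, u x ∂κ ≤ ∫ _, (1 : ℝ) ∂κ :=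
        integral_mono (integrable_comp_of_mem_Icc hu hu1) (integrable_const _) fun x => (hu1 x).2
    _ = 1 := by simp

theorem transitionOp_mem_Icc [IsProbabilityMeasure ν] (hg : Measurable g)
    (hg1 : ∀ x, g x ∈ Set.Icc (0 : ℝ) 1) (x : E) : transitionOp T ν g x ∈ Set.Icc (0 : ℝ) 1 :=
  integral_mem_Icc (hg.comp (measurable_const.add measurable_id)) fun _ => hg1 _

theorem iterate_transitionOp [IsProbabilityMeasure ν] (hg : Measurable g)
    (hg1 : ∀ x, g x ∈ Set.Icc (0 : ℝ) 1) (k : ℕ) :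
    Measurable ((transitionOp T ν)^[k] g) ∧
      ∀ x, (transitionOp T ν)^[k] g x ∈ Set.Icc (0 : ℝ) 1 := by
  induction k with
  | zero => exact ⟨hg, hg1⟩
  | succ k ih =>
    rw [Function.iterate_succ_apply']
    exact ⟨measurable_transitionOp ih.1, transitionOp_mem_Icc ih.1 ih.2⟩

/-- If the innovation law has a density `f`, translating the starting point changes the transition
operator by at most an integral against `|f (z - w) - f z|`, where `w` is the translation seen after
one step. -/
theorem abs_integral_translate_sub_le (μ : Measure E) [μ.IsAddHaarMeasure]
    [IsProbabilityMeasure ν] (hν : ν ≪ μ) (hint : Integrable (fun z : E => ‖z‖) ν)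
    {h : E → ℝ} (hh : Measurable h) (hh1 : ∀ x, h x ∈ Set.Icc (0 : ℝ) 1) {b c : ℝ}
    (hc : 0 ≤ c) (u w : E)
    (hb : ∀ z, |h (u + z) - h u| ≤ b * (1 + c * ‖z‖)) :
    |(∫ z, h (u + w + z) ∂ν) - ∫ z, h (u + z) ∂ν| ≤
      b * (∫ z, |(ν.rnDeriv μ (z - w)).toReal - (ν.rnDeriv μ z).toReal| ∂μ
        + c * (2 * ∫ z, ‖z‖ ∂ν + ‖w‖)) := by
  set f : E → ℝ := fun z => (ν.rnDeriv μ z).toReal with hf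
  have hf0 : ∀ z, 0 ≤ f z := fun z => ENNReal.toReal_nonneg
  have hfi : Integrable f μ := Measure.integrable_toReal_rnDeriv
  have key : ∀ k : E → ℝ, ∫ z, f z * k z ∂μ = ∫ z, k z ∂ν := fun k => by
    simpa using integral_rnDeriv_smul (f := k) hν
  have keyi : ∀ k : E → ℝ, Integrable k ν → Integrable (fun z => f z * k z) μ := fun k hk => by
    simpa using (integrable_rnDeriv_smul_iff (f := k) hν).2 hk
  have hfw : Integrable (fun z => f (z - w)) μ := hfi.comp_sub_right w
  have hb0 : 0 ≤ b := by
    have := (abs_nonneg _).trans (hb 0)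
    simpa using this
  have hhi : ∀ v : E, Integrable (fun z => h (v + z)) ν := fun v =>
    integrable_comp_of_mem_Icc (hh.comp (measurable_const.add measurable_id)) fun _ => hh1 _
  have e1 : ∫ z, h (u + w + z) ∂ν = ∫ z, f (z - w) * h (u + z) ∂μ := by
    rw [← key, ← integral_sub_right_eq_self _ w]
    refine integral_congr_ae (ae_of_all _ fun z => ?_)
    simp only [add_assoc, add_sub_cancel]
  have i1 : Integrable (fun z => f (z - w) * h (u + z)) μ := by
    refine ((keyi _ (hhi (u + w))).comp_sub_right w).congr (ae_of_all _ fun z => ?_)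
    simp only [add_assoc, add_sub_cancel]
  have i2 : Integrable (fun z => f z * h (u + z)) μ := keyi _ (hhi u)
  -- The difference of two translates of a density has integral zero, so the constant `h u` can be
  -- subtracted. Only the oscillation of `h` then enters, which is what preserves the factor `b`.
  have e0 : ∫ z, (f (z - w) - f z) * h u ∂μ = 0 := by
    rw [integral_mul_const, integral_sub hfw hfi, integral_sub_right_eq_self, sub_self, zero_mul]
  have e2 : (∫ z, h (u + w + z) ∂ν) - ∫ z, h (u + z) ∂ν
      = ∫ z, (f (z - w) - f z) * (h (u + z) - h u) ∂μ := by
    rw [e1, ← key, ← integral_sub i1 i2]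
    rw [← sub_zero (∫ z, (f (z - w) * h (u + z) - f z * h (u + z)) ∂μ), ← e0, ← integral_sub]
    · exact integral_congr_ae (ae_of_all _ fun z => by ring)
    · exact i1.sub i2
    · exact (hfw.sub hfi).mul_const _
  have iabs : Integrable (fun z => |f (z - w) - f z|) μ := (hfw.sub hfi).abs
  have in0 : Integrable (fun z => f z * ‖z‖) μ := keyi _ hint
  have inw' : Integrable (fun z => f z * ‖z + w‖) μ := by
    refine keyi _ ((hint.add (integrable_const ‖w‖)).mono'
      (by fun_prop) (ae_of_all _ fun z => ?_))
    simpa using norm_add_le z w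
  have inw : Integrable (fun z => f (z - w) * ‖z‖) μ := by
    simpa using inw'.comp_sub_right w
  have iabsn : Integrable (fun z => |f (z - w) - f z| * ‖z‖) μ := by
    refine (inw.add in0).mono' (iabs.1.mul (by fun_prop)) (ae_of_all _ fun z => ?_)
    rw [Real.norm_eq_abs, abs_mul, abs_abs, abs_norm, Pi.add_apply, ← add_mul]
    refine mul_le_mul_of_nonneg_right ?_ (norm_nonneg _)
    exact (abs_sub _ _).trans (by rw [abs_of_nonneg (hf0 _), abs_of_nonneg (hf0 _)])
  have e3 : ∫ z, |f (z - w) - f z| * ‖z‖ ∂μ ≤ 2 * ∫ z, ‖z‖ ∂ν + ‖w‖ := by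
    calc ∫ z, |f (z - w) - f z| * ‖z‖ ∂μ
        ≤ ∫ z, (f (z - w) * ‖z‖ + f z * ‖z‖) ∂μ := by
          refine integral_mono iabsn (inw.add in0) fun z => ?_
          simp only [← add_mul]
          refine mul_le_mul_of_nonneg_right ?_ (norm_nonneg _)
          exact (abs_sub _ _).trans (by rw [abs_of_nonneg (hf0 _), abs_of_nonneg (hf0 _)])
      _ = (∫ z, f (z - w) * ‖z‖ ∂μ) + ∫ z, f z * ‖z‖ ∂μ := integral_add inw in0
      _ = (∫ z, ‖z + w‖ ∂ν) + ∫ z, ‖z‖ ∂ν := by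
          rw [key, ← key (fun z => ‖z + w‖),
            ← integral_sub_right_eq_self (fun z => f z * ‖z + w‖) w]
          simp
      _ ≤ ((∫ z, ‖z‖ ∂ν) + ‖w‖) + ∫ z, ‖z‖ ∂ν := by
          refine add_le_add ?_ le_rfl
          calc ∫ z, ‖z + w‖ ∂ν ≤ ∫ z, (‖z‖ + ‖w‖) ∂ν := by
                refine integral_mono_of_nonneg (ae_of_all _ fun z => norm_nonneg _)
                  (hint.add (integrable_const _)) (ae_of_all _ fun z => norm_add_le z w)
            _ = (∫ z, ‖z‖ ∂ν) + ‖w‖ := by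
                rw [integral_add hint (integrable_const _)]; simp
      _ = _ := by ring
  rw [e2]
  calc |∫ z, (f (z - w) - f z) * (h (u + z) - h u) ∂μ|
      ≤ ∫ z, |(f (z - w) - f z) * (h (u + z) - h u)| ∂μ := abs_integral_le_integral_abs
    _ ≤ ∫ z, b * (|f (z - w) - f z| + c * (|f (z - w) - f z| * ‖z‖)) ∂μ := by
        refine integral_mono_of_nonneg (ae_of_all _ fun z => abs_nonneg _)
          ((iabs.add (iabsn.const_mul c)).const_mul b) (ae_of_all _ fun z => ?_)
        dsimp only
        rw [abs_mul]
        calc _ ≤ |f (z - w) - f z| * (b * (1 + c * ‖z‖)) :=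
              mul_le_mul_of_nonneg_left (hb z) (abs_nonneg _)
          _ = _ := by ring
    _ = b * (∫ z, |f (z - w) - f z| ∂μ + c * ∫ z, |f (z - w) - f z| * ‖z‖ ∂μ) := by
        rw [integral_const_mul, integral_add iabs (iabsn.const_mul c), integral_const_mul]
    _ ≤ _ := by gcongr

/-- Geometric loss of memory for an autoregression `x ↦ T x + η` whose innovation law has a density:
the functions `E g(x_k)` of the starting point flatten out geometrically, uniformly in `g` with
values in `[0, 1]`. -/
theorem exists_geometric_coupling (μ : Measure E) [μ.IsAddHaarMeasure]
    [IsProbabilityMeasure ν] (hν : ν ≪ μ) (hint : Integrable (fun z : E => ‖z‖) ν)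
    {N : E → ℝ} {C a : ℝ} (hN : ∀ v, ‖v‖ ≤ N v) (hNC : ∀ v, N v ≤ C * ‖v‖)
    (hNT : ∀ v, N (T v) ≤ a * N v) (hC : 1 ≤ C) (ha0 : 0 ≤ a) (ha1 : a < 1) :
    ∃ ρ K : ℝ, 0 ≤ ρ ∧ ρ < 1 ∧ 0 ≤ K ∧ ∀ g : E → ℝ, Measurable g →
      (∀ x, g x ∈ Set.Icc (0 : ℝ) 1) → ∀ (k : ℕ) (x v : E),
      |(transitionOp T ν)^[k] g (x + v) - (transitionOp T ν)^[k] g x| ≤ ρ ^ k * (1 + K * ‖v‖) := by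
  obtain ⟨δ, hδ, htr⟩ := exists_integral_abs_translate_sub_le μ
    (f := fun z => (ν.rnDeriv μ z).toReal) Measure.integrable_toReal_rnDeriv
    (r := 1 / 4) (by norm_num)
  set m : ℝ := ∫ z, ‖z‖ ∂ν with hm
  have hm0 : 0 ≤ m := integral_nonneg fun z => norm_nonneg z
  -- Chosen so that `c * (2 * m + δ) = 1 / 4` for the slope `c = s * (C / δ)` below. With the `1 /
  -- 4` from the continuity of translation, a near step then loses a factor `1 / 2`.
  set s : ℝ := δ / (4 * (C * (2 * m + δ))) with hs
  have hD : 0 < C * (2 * m + δ) := by positivity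
  have hs0 : 0 < s := by positivity
  have hs1 : s ≤ 1 := by
    rw [hs, div_le_one (by positivity)]
    nlinarith
  set ρ : ℝ := max (a ^ s) (1 / 2) with hρ
  have hρ0 : 0 ≤ ρ := le_max_of_le_right (by norm_num)
  have hρ1 : ρ < 1 := max_lt (Real.rpow_lt_one ha0 ha1 hs0) (by norm_num)
  have hN0 : ∀ v, 0 ≤ N v := fun v => (norm_nonneg v).trans (hN v)
  -- The weight is constant at distances up to `δ` and a small power beyond: the power contracts by
  -- `a ^ s` under `T`, while a small `s` makes the linear majorant of `φ` nearly flat.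
  set φ : E → ℝ := fun v => max 1 ((N v / δ) ^ s) with hφ
  have hφ1 : ∀ v, 1 ≤ φ v := fun v => le_max_left _ _
  set c : ℝ := s * (C / δ) with hc
  have hc0 : 0 ≤ c := by positivity
  have hφle : ∀ v, φ v ≤ 1 + c * ‖v‖ := fun v => by
    have h0 : 0 ≤ N v / δ := div_nonneg (hN0 v) hδ.le
    have h1 : (N v / δ) ^ s ≤ 1 + s * (N v / δ - 1) := by
      have := rpow_one_add_le_one_add_mul_self (s := N v / δ - 1) (by linarith) hs0.le hs1
      simpa using this
    have h2 : N v / δ ≤ C / δ * ‖v‖ := by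
      rw [div_mul_eq_mul_div]; gcongr; exact hNC v
    have h3 : s * (N v / δ) ≤ c * ‖v‖ := by
      rw [hc, mul_assoc]; gcongr
    have h4 : 0 ≤ c * ‖v‖ := by positivity
    refine max_le (by linarith) ?_
    have : s * (N v / δ - 1) ≤ s * (N v / δ) := by nlinarith
    linarith
  refine ⟨ρ, c, hρ0, hρ1, hc0, fun g hg hg1 k => ?_⟩
  -- The induction runs with `φ`, which contracts in the far case; the linear majorant is used only
  -- inside the near case and in the conclusion.
  suffices H : ∀ x v : E, |(transitionOp T ν)^[k] g (x + v) - (transitionOp T ν)^[k] g x|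
      ≤ ρ ^ k * φ v from
    fun x v => (H x v).trans (mul_le_mul_of_nonneg_left (hφle v) (by positivity))
  induction k with
  | zero =>
    intro x v
    have h1 := hg1 (x + v)
    have h2 := hg1 x
    simp only [Function.iterate_zero, id_eq, pow_zero, one_mul]
    refine le_trans ?_ (hφ1 v)
    rw [abs_le]
    constructor <;> linarith [h1.1, h1.2, h2.1, h2.2]
  | succ k ih =>
    intro x v
    obtain ⟨hm', hI⟩ := iterate_transitionOp (T := T) (ν := ν) hg hg1 k
    rw [Function.iterate_succ_apply']
    set h := (transitionOp T ν)^[k] g with hh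
    simp only [transitionOp, map_add]
    by_cases hfar : N (T v) ≤ δ
    · have hw : ‖T v‖ ≤ δ := (hN _).trans hfar
      have := abs_integral_translate_sub_le μ hν hint hm' hI (b := ρ ^ k) (c := c) hc0 (T x) (T v)
        fun z => (ih (T x) z).trans (mul_le_mul_of_nonneg_left (hφle z) (by positivity))
      refine this.trans ?_
      have h1 := htr (T v) hw
      have h2 : c * (2 * m + ‖T v‖) ≤ 1 / 4 := by
        calc c * (2 * m + ‖T v‖) ≤ c * (2 * m + δ) := by gcongr
          _ = 1 / 4 := by rw [hc, hs]; field_simp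
      have h3 : (1 : ℝ) / 2 ≤ ρ * φ v :=
        (le_max_right _ _).trans (le_mul_of_one_le_right hρ0 (hφ1 v))
      rw [pow_succ, mul_assoc (ρ ^ k)]
      refine mul_le_mul_of_nonneg_left ?_ (pow_nonneg hρ0 k)
      linarith
    -- Far apart: both paths receive the same innovation `z`, so their difference is just moved by
    -- `T`.
    · push Not at hfar
      have hi : ∀ u : E, Integrable (fun z => h (u + z)) ν := fun u =>
        integrable_comp_of_mem_Icc (hm'.comp (measurable_const.add measurable_id)) fun _ => hI _
      have h1 : |(∫ z, h (T x + T v + z) ∂ν) - ∫ z, h (T x + z) ∂ν| ≤ ρ ^ k * φ (T v) := by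
        rw [← integral_sub (hi _) (hi _)]
        have hle : ∀ᵐ z ∂ν, ‖h (T x + T v + z) - h (T x + z)‖ ≤ ρ ^ k * φ (T v) :=
          ae_of_all _ fun z => by
            rw [add_right_comm]
            exact ih (T x + z) (T v)
        simpa using norm_integral_le_of_norm_le_const hle
      refine h1.trans ?_
      rw [pow_succ, mul_assoc (ρ ^ k)]
      refine mul_le_mul_of_nonneg_left ?_ (by positivity)
      have h2 : 1 ≤ (N (T v) / δ) ^ s :=
        Real.one_le_rpow ((one_le_div hδ).2 hfar.le) hs0.le
      calc φ (T v) = (N (T v) / δ) ^ s := max_eq_right h2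
        _ ≤ (a * (N v / δ)) ^ s := by
            refine Real.rpow_le_rpow (div_nonneg (hN0 _) hδ.le) ?_ hs0.le
            rw [← mul_div_assoc]; gcongr; exact hNT v
        _ = a ^ s * (N v / δ) ^ s := Real.mul_rpow ha0 (div_nonneg (hN0 _) hδ.le)
        _ ≤ ρ * φ v := mul_le_mul (le_max_left _ _) (le_max_right _ _)
            (Real.rpow_nonneg (div_nonneg (hN0 _) hδ.le) _) hρ0

end Transition

/-! ### The moving average representation. -/

/-- The limit `∑_j T^j x_j` of the partial sums (arbitrary if they do not converge). -/
noncomputable def movingAverage {E : Type*} [NormedAddCommGroup E] [NormedSpace ℝ E]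
    (T : E →L[ℝ] E) (x : ℕ → E) : E :=
  limUnder atTop fun n => ∑ j ∈ Finset.range n, (T ^ j) (x j)

theorem ae_eq_pow_add_sum {E : Type*} [NormedAddCommGroup E] [NormedSpace ℝ E]
    {T : E →L[ℝ] E} {μ : Measure Ω} {η y : ℤ → Ω → E}
    (hy : ∀ t, ∀ᵐ ω ∂μ, y t ω = T (y (t - 1) ω) + η t ω) (t : ℤ) :
    ∀ᵐ ω ∂μ, ∀ n : ℕ,
      y t ω = (T ^ n) (y (t - n) ω) + ∑ j ∈ Finset.range n, (T ^ j) (η (t - j) ω) := by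
  filter_upwards [ae_all_iff.2 hy] with ω hω n
  induction n with
  | zero => simp
  | succ n ih =>
    rw [Finset.sum_range_succ, add_comm (∑ j ∈ _, _), ← add_assoc]
    refine ih.trans ?_
    congr 1
    conv_lhs => rw [hω (t - n)]
    rw [map_add, pow_succ, mul_apply_eq_comp]
    congr 4
    push_cast
    ring

section MovingAverage

variable {E : Type*} [NormedAddCommGroup E] [NormedSpace ℝ E] [FiniteDimensional ℝ E]
  [MeasurableSpace E] [BorelSpace E] {T : E →L[ℝ] E}

theorem measurable_movingAverage : Measurable (movingAverage T) := by
  have : CompleteSpace E := FiniteDimensional.complete ℝ E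
  have h : ∀ n, StronglyMeasurable fun x : ℕ → E => ∑ j ∈ Finset.range n, (T ^ j) (x j) :=
    fun n => (Finset.measurable_sum _ fun j _ =>
      (T ^ j).measurable.comp (measurable_pi_apply j)).stronglyMeasurable
  exact (StronglyMeasurable.limUnder h).measurable

variable {μ : Measure Ω} {η : ℤ → Ω → E}

theorem ae_summable_pow_apply (hη : ∀ t, Measurable (η t)) {R : ENNReal} (hR : R ≠ ⊤)
    (hηR : ∀ t, ∫⁻ ω, ‖η t ω‖ₑ ∂μ ≤ R) (hT : Summable fun n : ℕ => ‖T ^ n‖) (t : ℤ) :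
    ∀ᵐ ω ∂μ, Summable fun j : ℕ => (T ^ j) (η (t - j) ω) := by
  have : CompleteSpace E := FiniteDimensional.complete ℝ E
  have hmeas : ∀ j : ℕ, Measurable fun ω => ‖T ^ j‖ₑ * ‖η (t - j) ω‖ₑ := fun j =>
    (hη _).enorm.const_mul _
  have h1 : ∫⁻ ω, ∑' j : ℕ, ‖T ^ j‖ₑ * ‖η (t - j) ω‖ₑ ∂μ ≠ ⊤ := by
    rw [lintegral_tsum fun j => (hmeas j).aemeasurable]
    have h2 : ∑' j : ℕ, ∫⁻ ω, ‖T ^ j‖ₑ * ‖η (t - j) ω‖ₑ ∂μ ≤ ∑' j : ℕ, ‖T ^ j‖ₑ * R := by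
      refine ENNReal.tsum_le_tsum fun j => ?_
      rw [lintegral_const_mul _ (hη _).enorm]
      gcongr
      exact hηR _
    refine ne_top_of_le_ne_top ?_ h2
    rw [ENNReal.tsum_mul_right]
    refine ENNReal.mul_ne_top ?_ hR
    have h3 := hT.tsum_ofReal_ne_top
    simpa only [ofReal_norm] using h3
  filter_upwards [ae_lt_top (Measurable.tsum hmeas) h1] with ω hω
  refine Summable.of_enorm (ne_top_of_le_ne_top hω.ne (ENNReal.tsum_le_tsum fun j => ?_))
  exact (T ^ j).le_opENorm _

/-- A tight solution of `y_t = T y_{t-1} + η_t` is almost surely the limit of the partial sums of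
its moving average representation. -/
theorem ae_tendsto_movingAverage [IsProbabilityMeasure μ] {y : ℤ → Ω → E}
    (hη : ∀ t, Measurable (η t)) {R : ENNReal} (hR : R ≠ ⊤)
    (hηR : ∀ t, ∫⁻ ω, ‖η t ω‖ₑ ∂μ ≤ R) (hT : Summable fun n : ℕ => ‖T ^ n‖)
    (hy : ∀ t, ∀ᵐ ω ∂μ, y t ω = T (y (t - 1) ω) + η t ω)
    (htight : ∀ δ : ℝ, 0 < δ → ∃ K : ℝ, ∀ t : ℤ, μ.real {ω | K < ‖y t ω‖} ≤ δ) (t : ℤ) :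
    ∀ᵐ ω ∂μ, Tendsto (fun n => ∑ j ∈ Finset.range n, (T ^ j) (η (t - j) ω)) atTop
      (𝓝 (y t ω)) := by
  set P : ℕ → Ω → E := fun n ω => ∑ j ∈ Finset.range n, (T ^ j) (η (t - j) ω) with hP
  have hPm : ∀ n, Measurable (P n) := fun n => Finset.measurable_sum _ fun j _ =>
    (T ^ j).measurable.comp (hη _)
  set S : Ω → E := fun ω => ∑' j : ℕ, (T ^ j) (η (t - j) ω) with hS
  have h1 : ∀ᵐ ω ∂μ, Tendsto (fun n => P n ω) atTop (𝓝 (S ω)) := by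
    filter_upwards [ae_summable_pow_apply hη hR hηR hT t] with ω hω
    exact hω.hasSum.tendsto_sum_nat
  have h2 : TendstoInMeasure μ P atTop S :=
    tendstoInMeasure_of_tendsto_ae (fun n => (hPm n).aestronglyMeasurable) h1
  -- The partial sums differ from `y t` by `T ^ n` applied to `y (t - n)`; tightness is uniform in
  -- time, so this is small in probability. Limits in measure being unique, `y t` is the almost sure
  -- limit.
  have h3 : TendstoInMeasure μ P atTop (y t) := by
    rw [tendstoInMeasure_iff_measureReal_norm]
    intro r hr
    rw [Metric.tendsto_atTop]
    intro δ hδ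
    obtain ⟨K, hK⟩ := htight (δ / 2) (by positivity)
    have hlim : Tendsto (fun n => ‖T ^ n‖ * (|K| + 1)) atTop (𝓝 0) := by
      simpa using hT.tendsto_atTop_zero.mul_const (|K| + 1)
    obtain ⟨n₀, hn₀⟩ := eventually_atTop.1 (hlim.eventually_lt_const hr)
    refine ⟨n₀, fun n hn => ?_⟩
    rw [Real.dist_eq, sub_zero, abs_of_nonneg measureReal_nonneg]
    refine lt_of_le_of_lt (le_trans ?_ (hK (t - n))) (by linarith : δ / 2 < δ)
    refine ENNReal.toReal_mono (measure_ne_top _ _) (measure_mono_ae ?_)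
    filter_upwards [ae_eq_pow_add_sum hy t] with ω hω hle
    change r ≤ ‖P n ω - y t ω‖ at hle
    change K < ‖y (t - n) ω‖
    by_contra hcon
    push Not at hcon
    have h4 : P n ω - y t ω = -(T ^ n) (y (t - n) ω) := by
      rw [hω n]; simp [hP]
    rw [h4, norm_neg] at hle
    have h5 : ‖(T ^ n) (y (t - n) ω)‖ ≤ ‖T ^ n‖ * (|K| + 1) := by
      refine ((T ^ n).le_opNorm _).trans ?_
      gcongr
      linarith [le_abs_self K]
    linarith [hn₀ n hn]
  filter_upwards [h1, tendstoInMeasure_ae_unique h2 h3] with ω hω hω2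
  rwa [← hω2]

end MovingAverage

/-! ### Generated σ-algebras and independence. -/

theorem sigmaGen_eq_comap {Ω : Type*} {p : ℕ} (y : ℤ → Ω → Fin p → ℝ) (I : Set ℤ) :
    sigmaGen y I = MeasurableSpace.comap (fun ω (t : I) => y t ω) inferInstance := by
  have h : (inferInstance : MeasurableSpace (I → Fin p → ℝ)) =
      ⨆ t : I, MeasurableSpace.comap (fun x => x t) inferInstance := rfl
  rw [h, MeasurableSpace.comap_iSup, sigmaGen, iSup_subtype']
  simp only [MeasurableSpace.comap_comp]
  rfl

theorem measurable_sigmaGen {Ω : Type*} {p : ℕ} (y : ℤ → Ω → Fin p → ℝ) {I : Set ℤ} {t : ℤ} (ht : t ∈ I) :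
    Measurable[sigmaGen y I] (y t) :=
  Measurable.of_comap_le (le_iSup₂_of_le t ht le_rfl)

theorem sigmaGen_mono {Ω : Type*} {p : ℕ} (y : ℤ → Ω → Fin p → ℝ) {I J : Set ℤ} (h : I ⊆ J) :
    sigmaGen y I ≤ sigmaGen y J :=
  biSup_mono h

theorem sigmaGen_le {p : ℕ} {y : ℤ → Ω → Fin p → ℝ} (hy : ∀ t, Measurable (y t)) (I : Set ℤ) :
    sigmaGen y I ≤ ‹MeasurableSpace Ω› :=
  iSup₂_le fun t _ => (hy t).comap_le

theorem sigmaGen_le_of_measurable {Ω : Type*} {p : ℕ} {y : ℤ → Ω → Fin p → ℝ} {I : Set ℤ}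
    {m : MeasurableSpace Ω} (h : ∀ t ∈ I, Measurable[m] (y t)) : sigmaGen y I ≤ m :=
  iSup₂_le fun t ht => (h t ht).comap_le

/-- Events of a process agree almost surely with events of any modification of it. -/
theorem exists_measurableSet_sigmaGen_ae_eq {p : ℕ} {μ : Measure Ω} {y y' : ℤ → Ω → Fin p → ℝ}
    (h : ∀ t, y t =ᵐ[μ] y' t) {I : Set ℤ} {A : Set Ω} (hA : MeasurableSet[sigmaGen y I] A) :
    ∃ A', MeasurableSet[sigmaGen y' I] A' ∧ A =ᵐ[μ] A' := by
  rw [sigmaGen_eq_comap] at hA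
  obtain ⟨D, hD, rfl⟩ := hA
  refine ⟨(fun ω (t : I) => y' t ω) ⁻¹' D, ?_, ?_⟩
  · rw [sigmaGen_eq_comap]
    exact ⟨D, hD, rfl⟩
  · filter_upwards [ae_all_iff.2 h] with ω hω
    have h1 : (fun t : I => y t ω) = fun t : I => y' t ω := funext fun t => hω t
    change ((fun t : I => y t ω) ∈ D) = ((fun t : I => y' t ω) ∈ D)
    rw [h1]

theorem indep_sigmaGen {p : ℕ} {μ : Measure Ω} {η : ℤ → Ω → Fin p → ℝ}
    (hη : ∀ t, Measurable (η t)) (hind : iIndepFun η μ) {I J : Set ℤ} (h : Disjoint I J) :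
    Indep (sigmaGen η I) (sigmaGen η J) μ :=
  indep_iSup_of_disjoint (fun t => (hη t).comap_le) hind.iIndep h

/-- Integrating out an independent variable. -/
theorem integral_comp_prodMk_of_indepFun {α β : Type*} [MeasurableSpace α] [MeasurableSpace β]
    {μ : Measure Ω} [IsProbabilityMeasure μ] {X : Ω → α} {Z : Ω → β} (hX : Measurable X)
    (hZ : Measurable Z) (h : IndepFun X Z μ) {u : α × β → ℝ} (hu : Measurable u)
    (hi : Integrable (fun ω => u (X ω, Z ω)) μ) :
    ∫ ω, u (X ω, Z ω) ∂μ = ∫ ω, ∫ z, u (X ω, z) ∂(μ.map Z) ∂μ := by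
  have : IsProbabilityMeasure (μ.map Z) := Measure.isProbabilityMeasure_map hZ.aemeasurable
  have : IsProbabilityMeasure (μ.map X) := Measure.isProbabilityMeasure_map hX.aemeasurable
  have hXZ := hX.prodMk hZ
  have hprod := h.map_prod_eq_prod_map_map hX.aemeasurable hZ.aemeasurable
  have hi' : Integrable u ((μ.map X).prod (μ.map Z)) := by
    rw [← hprod]
    exact (integrable_map_measure hu.aestronglyMeasurable hXZ.aemeasurable).2 hi
  rw [← integral_map hXZ.aemeasurable (f := u) hu.aestronglyMeasurable, hprod,
    integral_prod _ hi', integral_map hX.aemeasurable]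
  exact hu.stronglyMeasurable.integral_prod_right'.aestronglyMeasurable

/-! ### Stable autoregressions: stationarity. -/

/-- A tight solution `y` of `y_t = T y_{t-1} + η_t` with stable `T` and i.i.d. innovations `η_t`
whose law has a Lebesgue density and a finite first moment. -/
structure StableAutoregression {p : ℕ} (μ : Measure Ω)
    (T : (Fin p → ℝ) →L[ℝ] (Fin p → ℝ)) (η y : ℤ → Ω → Fin p → ℝ) : Prop where
  measurable_innovation : ∀ t, Measurable (η t)
  indep : iIndepFun η μ
  identDistrib : ∀ s t, IdentDistrib (η s) (η t) μ μ
  lintegral_innovation : ∫⁻ ω, ‖η 0 ω‖ₑ ∂μ < ⊤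
  absolutelyContinuous : μ.map (η 0) ≪ volume
  summable : Summable fun n : ℕ => ‖T ^ n‖
  measurable : ∀ t, Measurable (y t)
  recursion : ∀ t, ∀ᵐ ω ∂μ, y t ω = T (y (t - 1) ω) + η t ω
  tight : BoundedInProbability μ y

namespace StableAutoregression

variable {p : ℕ} {μ : Measure Ω} [IsProbabilityMeasure μ]
  {T : (Fin p → ℝ) →L[ℝ] (Fin p → ℝ)} {η y : ℤ → Ω → Fin p → ℝ}

theorem ae_tendsto (H : StableAutoregression μ T η y) (t : ℤ) :
    ∀ᵐ ω ∂μ, Tendsto (fun n => ∑ j ∈ Finset.range n, (T ^ j) (η (t - j) ω)) atTop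
      (𝓝 (y t ω)) := by
  refine ae_tendsto_movingAverage H.measurable_innovation H.lintegral_innovation.ne (fun s => ?_)
    H.summable H.recursion H.tight t
  exact ((H.identDistrib s 0).comp measurable_enorm).lintegral_eq.le

/-- The moving average representation, as a modification adapted to the innovations. -/
noncomputable def causal {Ω : Type*} {p : ℕ} (T : (Fin p → ℝ) →L[ℝ] (Fin p → ℝ)) (η : ℤ → Ω → Fin p → ℝ) (t : ℤ)
    (ω : Ω) : Fin p → ℝ :=
  movingAverage T fun j => η (t - j) ω

theorem ae_eq_causal (H : StableAutoregression μ T η y) (t : ℤ) : y t =ᵐ[μ] causal T η t := by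
  filter_upwards [H.ae_tendsto t] with ω hω
  exact hω.limUnder_eq.symm

theorem measurable_causal {Ω : Type*} {p : ℕ} {T : (Fin p → ℝ) →L[ℝ] (Fin p → ℝ)}
    {η : ℤ → Ω → Fin p → ℝ} {I : Set ℤ} {t : ℤ} (h : ∀ j : ℕ, t - j ∈ I) :
    Measurable[sigmaGen η I] (causal T η t) := by
  refine @Measurable.comp _ _ _ (sigmaGen η I) _ _ _ _ measurable_movingAverage ?_
  exact @measurable_pi_lambda _ _ _ (sigmaGen η I) _ _ fun j => measurable_sigmaGen η (h j)

/-- The path of `y` is almost surely a fixed measurable, shift-equivariant function of the path of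
the innovations, whose law is an infinite product of equal factors and hence shift invariant. -/
theorem strictlyStationary (H : StableAutoregression μ T η y) : StrictlyStationary μ y := by
  intro h
  set F : (ℤ → Fin p → ℝ) → ℤ → Fin p → ℝ := fun x t => movingAverage T fun j => x (t - j) with hF
  have hFm : Measurable F := measurable_pi_lambda _ fun t =>
    measurable_movingAverage.comp (measurable_pi_lambda _ fun j => measurable_pi_apply _)
  have hid : IdentDistrib (fun ω (t : ℤ) => η (t + h) ω) (fun ω (t : ℤ) => η t ω) μ μ := by
    refine ⟨(measurable_pi_lambda _ fun t => H.measurable_innovation _).aemeasurable,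
      (measurable_pi_lambda _ fun t => H.measurable_innovation _).aemeasurable, ?_⟩
    rw [H.indep.map_fun_eq_infinitePi_map H.measurable_innovation,
      (H.indep.precomp (add_left_injective h)).map_fun_eq_infinitePi_map
        fun t => H.measurable_innovation _]
    congr 1
    funext t
    exact (H.identDistrib _ _).map_eq
  have h1 : (fun ω (t : ℤ) => y (t + h) ω) =ᵐ[μ] F ∘ fun ω (t : ℤ) => η (t + h) ω := by
    filter_upwards [ae_all_iff.2 H.ae_eq_causal] with ω hω
    funext t
    rw [hω (t + h)]
    simp only [causal, hF, Function.comp]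
    congr 1
    funext j
    congr 1
    ring
  have h2 : (fun ω (t : ℤ) => y t ω) =ᵐ[μ] F ∘ fun ω (t : ℤ) => η t ω := by
    filter_upwards [ae_all_iff.2 H.ae_eq_causal] with ω hω
    funext t
    exact hω t
  have hm : ∀ k : ℤ, Measurable fun ω (t : ℤ) => y (t + k) ω := fun k =>
    measurable_pi_lambda _ fun t => H.measurable _
  have hc := hid.comp hFm
  exact (IdentDistrib.of_ae_eq (hm h).aemeasurable h1).trans
    (hc.trans (IdentDistrib.of_ae_eq
      (measurable_pi_lambda _ fun t => H.measurable _).aemeasurable h2).symm)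

end StableAutoregression

/-! ### Geometric decay of the mixing coefficients. -/

namespace StableAutoregression

variable {p : ℕ} {μ : Measure Ω}
  {T : (Fin p → ℝ) →L[ℝ] (Fin p → ℝ)} {η y : ℤ → Ω → Fin p → ℝ}

/-- The path from time `0` on, as a function of the starting point and the later innovations. -/
def flow (T : (Fin p → ℝ) →L[ℝ] (Fin p → ℝ)) (x : Fin p → ℝ) (z : ℕ → Fin p → ℝ) : ℕ → Fin p → ℝ
  | 0 => x
  | n + 1 => T (flow T x z n) + z n

theorem measurable_flow (n : ℕ) :
    Measurable fun q : (Fin p → ℝ) × (ℕ → Fin p → ℝ) => flow T q.1 q.2 n := by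
  induction n with
  | zero => exact measurable_fst
  | succ n ih =>
    exact (T.measurable.comp ih).add ((measurable_pi_apply n).comp measurable_snd)

theorem measurable_causal' (H : StableAutoregression μ T η y) (t : ℤ) :
    Measurable (causal T η t) :=
  (measurable_causal (I := Set.univ) fun _ => Set.mem_univ _).mono
    (sigmaGen_le H.measurable_innovation _) le_rfl

/-- The adapted norm is `N v = ∑ ‖T^n v‖`. Since `N (T v) = N v - ‖v‖` and `‖v‖ ≥ N v / C`, it
contracts by `1 - 1/C`. -/
theorem exists_stability_functional (hT : Summable fun n : ℕ => ‖T ^ n‖) :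
    ∃ (N : (Fin p → ℝ) → ℝ) (C a : ℝ), (∀ v, ‖v‖ ≤ N v) ∧ (∀ v, N v ≤ C * ‖v‖) ∧
      (∀ v, N (T v) ≤ a * N v) ∧ 1 ≤ C ∧ 0 ≤ a ∧ a < 1 := by
  set C : ℝ := max 1 (∑' n : ℕ, ‖T ^ n‖) with hC
  have hC1 : 1 ≤ C := le_max_left _ _
  have hs : ∀ v, Summable fun n : ℕ => ‖(T ^ n) v‖ := fun v =>
    Summable.of_nonneg_of_le (fun n => norm_nonneg _) (fun n => (T ^ n).le_opNorm v)
      (hT.mul_right _)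
  have hsplit : ∀ v, ∑' n : ℕ, ‖(T ^ n) v‖ = ‖v‖ + ∑' n : ℕ, ‖(T ^ n) (T v)‖ := fun v => by
    rw [(hs v).tsum_eq_zero_add]
    simp [pow_succ]
  have hNC : ∀ v, ∑' n : ℕ, ‖(T ^ n) v‖ ≤ C * ‖v‖ := fun v => by
    calc ∑' n : ℕ, ‖(T ^ n) v‖ ≤ ∑' n : ℕ, ‖T ^ n‖ * ‖v‖ :=
          (hs v).tsum_le_tsum (fun n => (T ^ n).le_opNorm v) (hT.mul_right _)
      _ = (∑' n : ℕ, ‖T ^ n‖) * ‖v‖ := tsum_mul_right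
      _ ≤ C * ‖v‖ := by gcongr; exact le_max_right _ _
  refine ⟨fun v => ∑' n : ℕ, ‖(T ^ n) v‖, C, 1 - C⁻¹, fun v => ?_, hNC, fun v => ?_, hC1, ?_, ?_⟩
  · change ‖v‖ ≤ ∑' n : ℕ, ‖(T ^ n) v‖
    rw [hsplit v]
    exact le_add_of_nonneg_right (tsum_nonneg fun n => norm_nonneg _)
  · have h1 : C⁻¹ * ∑' n : ℕ, ‖(T ^ n) v‖ ≤ ‖v‖ := by
      rw [inv_mul_le_iff₀ (by positivity)]
      exact hNC v
    linarith [hsplit v]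
  · linarith [inv_le_one_of_one_le₀ hC1]
  · linarith [inv_pos.2 (zero_lt_one.trans_le hC1)]

theorem alphaCoef_nonneg (k : ℕ) : 0 ≤ alphaCoef μ y k :=
  Real.sSup_nonneg fun _ ⟨_, _, _, _, hr⟩ => hr ▸ abs_nonneg _

/-- The integrands below see the past only through the indicator of `A` and the present state, so
this pair is all that has to be separated from later innovations. The adapted version `causal` is
needed because `y` itself is only almost surely a function of the innovations. -/
theorem indepFun_past (H : StableAutoregression μ T η y) {k : ℤ} {A : Set Ω}
    (hA : MeasurableSet[sigmaGen η (Set.Iic k)] A) {β : Type*} [MeasurableSpace β] {Z : Ω → β}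
    (hZ : Measurable[sigmaGen η (Set.Ioi k)] Z) :
    IndepFun (fun ω => (A.indicator (fun _ => (1 : ℝ)) ω, causal T η k ω)) Z μ := by
  have h1 : Measurable[sigmaGen η (Set.Iic k)]
      fun ω => (A.indicator (fun _ => (1 : ℝ)) ω, causal T η k ω) :=
    Measurable.prodMk (Measurable.indicator measurable_const hA)
      (measurable_causal fun j => by simp only [Set.mem_Iic]; omega)
  have h := indep_sigmaGen H.measurable_innovation H.indep
    (I := Set.Iic k) (J := Set.Ioi k) (Set.Iic_disjoint_Ioi le_rfl)
  rw [IndepFun_iff_Indep]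
  exact indep_of_indep_of_le_left (indep_of_indep_of_le_right h hZ.comap_le) h1.comap_le

variable [IsProbabilityMeasure μ]

theorem ae_causal_recursion (H : StableAutoregression μ T η y) (t : ℤ) :
    ∀ᵐ ω ∂μ, causal T η (t + 1) ω = T (causal T η t ω) + η (t + 1) ω := by
  filter_upwards [H.recursion (t + 1), H.ae_eq_causal (t + 1), H.ae_eq_causal t] with ω h1 h2 h3
  rw [← h2, h1, add_sub_cancel_right, h3]

theorem integrable_indicator_mul {A : Set Ω} (hA : MeasurableSet A) {u : Ω → ℝ}
    (hu : Measurable u) (hu1 : ∀ x, u x ∈ Set.Icc (0 : ℝ) 1) :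
    Integrable (fun ω => A.indicator (fun _ => (1 : ℝ)) ω * u ω) μ := by
  refine integrable_comp_of_mem_Icc ((measurable_const.indicator hA).mul hu) fun ω => ?_
  by_cases h : ω ∈ A <;> simp [h, (hu1 ω).1, (hu1 ω).2]

/-- Conditioning on the past one innovation at a time. -/
theorem integral_indicator_mul_causal (H : StableAutoregression μ T η y) {A : Set Ω}
    (hA : MeasurableSet[sigmaGen η (Set.Iic 0)] A) (k : ℕ) :
    ∀ g : (Fin p → ℝ) → ℝ, Measurable g → (∀ x, g x ∈ Set.Icc (0 : ℝ) 1) →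
      ∫ ω, A.indicator (fun _ => (1 : ℝ)) ω * g (causal T η k ω) ∂μ =
        ∫ ω, A.indicator (fun _ => (1 : ℝ)) ω *
          (transitionOp T (μ.map (η 0)))^[k] g (causal T η 0 ω) ∂μ := by
  have : IsProbabilityMeasure (μ.map (η 0)) :=
    Measure.isProbabilityMeasure_map (H.measurable_innovation 0).aemeasurable
  have hA' : MeasurableSet A := sigmaGen_le H.measurable_innovation _ _ hA
  induction k with
  | zero => intro g _ _; simp
  | succ k ih =>
    intro g hg hg1
    -- Integrating out the innovation at time `k + 1` replaces `g` by its transition at time `k`;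
    -- the induction hypothesis is then used for this new function, hence the quantifier over `g`.
    rw [Function.iterate_succ_apply,
      ← ih _ (measurable_transitionOp hg) (transitionOp_mem_Icc hg hg1)]
    have hAk : MeasurableSet[sigmaGen η (Set.Iic (k : ℤ))] A :=
      sigmaGen_mono η (Set.Iic_subset_Iic.2 (by positivity)) _ hA
    have hind := H.indepFun_past hAk (Z := η (k + 1)) (measurable_sigmaGen η (by simp))
    have hX : Measurable fun ω => (A.indicator (fun _ => (1 : ℝ)) ω, causal T η k ω) :=
      (measurable_const.indicator hA').prodMk (H.measurable_causal' k)
    have hu : Measurable fun q : (ℝ × (Fin p → ℝ)) × (Fin p → ℝ) =>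
        q.1.1 * g (T q.1.2 + q.2) := by
      refine (measurable_fst.comp measurable_fst).mul (hg.comp ?_)
      exact (T.measurable.comp (measurable_snd.comp measurable_fst)).add measurable_snd
    have key := integral_comp_prodMk_of_indepFun hX (H.measurable_innovation (k + 1)) hind hu
      (integrable_indicator_mul hA' (hg.comp ((T.measurable.comp (H.measurable_causal' k)).add
        (H.measurable_innovation (k + 1)))) fun _ => hg1 _)
    have e1 : ∫ ω, A.indicator (fun _ => (1 : ℝ)) ω * g (causal T η ((k + 1 : ℕ) : ℤ) ω) ∂μ =
        ∫ ω, A.indicator (fun _ => (1 : ℝ)) ω * g (T (causal T η k ω) + η (k + 1) ω) ∂μ := by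
      refine integral_congr_ae ?_
      filter_upwards [H.ae_causal_recursion k] with ω hω
      push_cast
      rw [hω]
    rw [e1, key, (H.identDistrib (k + 1) 0).map_eq]
    refine integral_congr_ae (ae_of_all _ fun ω => ?_)
    simp only [transitionOp, integral_const_mul]

/-- An event of the future of the process, seen from the past through a bounded function of the
present state. -/
theorem exists_future_function (H : StableAutoregression μ T η y) (k : ℕ) {B : Set Ω}
    (hB : MeasurableSet[sigmaGen y (Set.Ici (k : ℤ))] B) :
    ∃ g : (Fin p → ℝ) → ℝ, Measurable g ∧ (∀ x, g x ∈ Set.Icc (0 : ℝ) 1) ∧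
      ∀ A : Set Ω, MeasurableSet[sigmaGen η (Set.Iic 0)] A →
        μ.real (A ∩ B) = ∫ ω, A.indicator (fun _ => (1 : ℝ)) ω * g (causal T η k ω) ∂μ := by
  rw [sigmaGen_eq_comap] at hB
  obtain ⟨D, hD, rfl⟩ := hB
  set Z : Ω → ℕ → Fin p → ℝ := fun ω m => η (k + 1 + m) ω with hZ
  have hZm : Measurable Z := measurable_pi_lambda _ fun m => H.measurable_innovation _
  have hZm' : Measurable[sigmaGen η (Set.Ioi (k : ℤ))] Z :=
    @measurable_pi_lambda _ _ _ (sigmaGen η (Set.Ioi (k : ℤ))) _ _ fun m =>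
      measurable_sigmaGen η (by simp only [Set.mem_Ioi]; omega)
  have : IsProbabilityMeasure (μ.map Z) := Measure.isProbabilityMeasure_map hZm.aemeasurable
  set Φ : (Fin p → ℝ) × (ℕ → Fin p → ℝ) → (Set.Ici (k : ℤ) → Fin p → ℝ) :=
    fun q t => flow T q.1 q.2 ((t : ℤ) - k).toNat with hΦ
  have hΦm : Measurable Φ := measurable_pi_lambda _ fun t => measurable_flow _
  set b : (Fin p → ℝ) × (ℕ → Fin p → ℝ) → ℝ := (Φ ⁻¹' D).indicator fun _ => 1 with hb
  have hbm : Measurable b := measurable_const.indicator (hΦm hD)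
  have hb1 : ∀ q, b q ∈ Set.Icc (0 : ℝ) 1 := fun q => by
    by_cases h : q ∈ Φ ⁻¹' D <;> simp [hb, h]
  have hpath : ∀ᵐ ω ∂μ, (fun t : Set.Ici (k : ℤ) => y t ω) = Φ (causal T η k ω, Z ω) := by
    filter_upwards [ae_all_iff.2 H.recursion, H.ae_eq_causal k] with ω h1 h2
    have h3 : ∀ n : ℕ, y (k + n) ω = flow T (causal T η k ω) (Z ω) n := by
      intro n
      induction n with
      | zero => simpa [flow] using h2
      | succ n ih =>
        rw [flow, ← ih, h1]
        have e1 : (k : ℤ) + (n + 1 : ℕ) - 1 = k + n := by push_cast; ring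
        have e2 : (k : ℤ) + (n + 1 : ℕ) = k + 1 + n := by push_cast; ring
        rw [e1, e2]
    funext t
    have ht : (k : ℤ) ≤ t := t.2
    have e : (t : ℤ) = k + (((t : ℤ) - k).toNat : ℕ) := by omega
    change y (t : ℤ) ω = flow T (causal T η k ω) (Z ω) ((t : ℤ) - k).toNat
    rw [← h3, ← e]
  -- The witness is the probability that the path started from `x` at time `k` and driven by the
  -- innovations from `k + 1` on lies in `D`.
  refine ⟨fun x => ∫ z, b (x, z) ∂(μ.map Z),
    (hbm.stronglyMeasurable.integral_prod_right' (ν := μ.map Z)).measurable,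
    fun x => integral_mem_Icc (hbm.comp measurable_prodMk_left) fun _ => hb1 _, fun A hA => ?_⟩
  have hA' : MeasurableSet A := sigmaGen_le H.measurable_innovation _ _ hA
  have hAk : MeasurableSet[sigmaGen η (Set.Iic (k : ℤ))] A :=
    sigmaGen_mono η (Set.Iic_subset_Iic.2 (by positivity)) _ hA
  have hind := H.indepFun_past hAk hZm'
  have hX : Measurable fun ω => (A.indicator (fun _ => (1 : ℝ)) ω, causal T η k ω) :=
    (measurable_const.indicator hA').prodMk (H.measurable_causal' k)
  have hu : Measurable fun q : (ℝ × (Fin p → ℝ)) × (ℕ → Fin p → ℝ) =>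
      q.1.1 * b (q.1.2, q.2) :=
    (measurable_fst.comp measurable_fst).mul
      (hbm.comp ((measurable_snd.comp measurable_fst).prodMk measurable_snd))
  have key := integral_comp_prodMk_of_indepFun hX hZm hind hu
    (integrable_indicator_mul hA' (hbm.comp ((H.measurable_causal' k).prodMk hZm)) fun _ => hb1 _)
  simp only [integral_const_mul] at key
  rw [← key]
  have hBm : MeasurableSet ((fun ω (t : Set.Ici (k : ℤ)) => y t ω) ⁻¹' D) :=
    (measurable_pi_lambda _ fun t : Set.Ici (k : ℤ) => H.measurable t) hD
  rw [← integral_indicator_one (hA'.inter hBm)]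
  refine integral_congr_ae ?_
  filter_upwards [hpath] with ω hω
  by_cases h1 : ω ∈ A <;> by_cases h2 : Φ (causal T η k ω, Z ω) ∈ D <;>
    simp [hb, h1, h2, Set.indicator, hω]

/-- The α-mixing coefficients of a stable autoregression whose innovations have a density decay
geometrically. -/
theorem exists_abs_sub_le_geometric (H : StableAutoregression μ T η y)
    (hy : Integrable (fun ω => ‖y 0 ω‖) μ) :
    ∃ K ρ : ℝ, 0 ≤ ρ ∧ ρ < 1 ∧ ∀ (k : ℕ) (A B : Set Ω),
      MeasurableSet[sigmaGen y (Set.Iic 0)] A → MeasurableSet[sigmaGen y (Set.Ici (k : ℤ))] B →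
      |μ.real A * μ.real B - μ.real (A ∩ B)| ≤ K * ρ ^ k := by
  have : IsProbabilityMeasure (μ.map (η 0)) :=
    Measure.isProbabilityMeasure_map (H.measurable_innovation 0).aemeasurable
  have hint : Integrable (fun z : Fin p → ℝ => ‖z‖) (μ.map (η 0)) := by
    rw [integrable_map_measure (by fun_prop) (H.measurable_innovation 0).aemeasurable]
    refine ⟨((H.measurable_innovation 0).norm).aestronglyMeasurable, ?_⟩
    simpa [HasFiniteIntegral] using H.lintegral_innovation
  obtain ⟨N, C, a, hN, hNC, hNT, hC, ha0, ha1⟩ := exists_stability_functional H.summable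
  obtain ⟨ρ, K, hρ0, hρ1, hK, hcoup⟩ := exists_geometric_coupling volume H.absolutelyContinuous
    hint hN hNC hNT hC ha0 ha1
  set m : ℝ := ∫ ω, ‖causal T η 0 ω‖ ∂μ with hm
  have hci : Integrable (fun ω => ‖causal T η 0 ω‖) μ :=
    hy.congr ((H.ae_eq_causal 0).mono fun ω h => congrArg norm h)
  refine ⟨2 * (1 + K * m), ρ, hρ0, hρ1, fun k A B hA hB => ?_⟩
  -- `A'` lies in the past of the innovations, whereas `A` does so only up to a null set.
  obtain ⟨A', hA', hAA'⟩ := exists_measurableSet_sigmaGen_ae_eq H.ae_eq_causal hA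
  have hle : sigmaGen (causal T η) (Set.Iic 0) ≤ sigmaGen η (Set.Iic 0) :=
    sigmaGen_le_of_measurable fun t ht => measurable_causal fun j => by
      simp only [Set.mem_Iic] at ht ⊢; omega
  have hA'' : MeasurableSet[sigmaGen η (Set.Iic 0)] A' := hle _ hA'
  have hA3 : MeasurableSet A' := sigmaGen_le H.measurable_innovation _ _ hA''
  obtain ⟨g, hg, hg1, hgB⟩ := H.exists_future_function k hB
  set h := (transitionOp T (μ.map (η 0)))^[k] g with hh
  obtain ⟨hhm, hh1⟩ := iterate_transitionOp (T := T) (ν := μ.map (η 0)) hg hg1 k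
  have e1 : μ.real (A' ∩ B) = ∫ ω, A'.indicator (fun _ => (1 : ℝ)) ω * h (causal T η 0 ω) ∂μ := by
    rw [hgB A' hA'', H.integral_indicator_mul_causal hA'' k g hg hg1]
  have e2 : μ.real B = ∫ ω, h (causal T η 0 ω) ∂μ := by
    have := hgB Set.univ MeasurableSet.univ
    rw [H.integral_indicator_mul_causal MeasurableSet.univ k g hg hg1] at this
    simpa using this
  -- The origin serves as a deterministic reference point; any other would only change the constant.
  have hdiff : ∀ ω, |h (causal T η 0 ω) - h 0| ≤ ρ ^ k * (1 + K * ‖causal T η 0 ω‖) := fun ω => by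
    simpa using hcoup g hg hg1 k 0 (causal T η 0 ω)
  have hbi : Integrable (fun ω => ρ ^ k * (1 + K * ‖causal T η 0 ω‖)) μ :=
    ((integrable_const _).add (hci.const_mul K)).const_mul _
  have hbe : ∫ ω, ρ ^ k * (1 + K * ‖causal T η 0 ω‖) ∂μ = ρ ^ k * (1 + K * m) := by
    rw [integral_const_mul, integral_add (integrable_const _) (hci.const_mul K),
      integral_const_mul, integral_const, probReal_univ, one_smul]
  have hhi : Integrable (fun ω => h (causal T η 0 ω)) μ :=
    integrable_comp_of_mem_Icc (hhm.comp (H.measurable_causal' 0)) fun _ => hh1 _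
  have hAi : Integrable (fun ω => A'.indicator (fun _ => (1 : ℝ)) ω * h (causal T η 0 ω)) μ :=
    integrable_indicator_mul hA3 (hhm.comp (H.measurable_causal' 0)) fun _ => hh1 _
  have hAc : Integrable (A'.indicator fun _ => (1 : ℝ)) μ :=
    (integrable_const _).indicator hA3
  have hAint : ∫ ω, A'.indicator (fun _ => (1 : ℝ)) ω ∂μ = μ.real A' := integral_indicator_one hA3
  have b1 : |μ.real B - h 0| ≤ ρ ^ k * (1 + K * m) := by
    have : μ.real B - h 0 = ∫ ω, (h (causal T η 0 ω) - h 0) ∂μ := by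
      rw [integral_sub hhi (integrable_const _), e2]; simp
    rw [this, ← hbe]
    exact norm_integral_le_of_norm_le (f := fun ω => h (causal T η 0 ω) - h 0) hbi
      (ae_of_all _ hdiff)
  have b2 : |μ.real (A' ∩ B) - μ.real A' * h 0| ≤ ρ ^ k * (1 + K * m) := by
    have : μ.real (A' ∩ B) - μ.real A' * h 0 =
        ∫ ω, A'.indicator (fun _ => (1 : ℝ)) ω * (h (causal T η 0 ω) - h 0) ∂μ := by
      simp only [mul_sub]
      rw [integral_sub hAi (hAc.mul_const _), integral_mul_const, e1, hAint]
    rw [this, ← hbe]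
    refine norm_integral_le_of_norm_le
      (f := fun ω => A'.indicator (fun _ => (1 : ℝ)) ω * (h (causal T η 0 ω) - h 0)) hbi
      (ae_of_all _ fun ω => ?_)
    refine le_trans ?_ (hdiff ω)
    by_cases hω : ω ∈ A' <;> simp [hω]
  have m1 : μ.real A = μ.real A' := measureReal_congr hAA'
  have m2 : μ.real (A ∩ B) = μ.real (A' ∩ B) :=
    measureReal_congr (hAA'.inter (ae_eq_refl B))
  rw [m1, m2]
  have e3 : μ.real A' * μ.real B - μ.real (A' ∩ B) =
      μ.real A' * (μ.real B - h 0) - (μ.real (A' ∩ B) - μ.real A' * h 0) := by ring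
  rw [e3]
  refine (abs_sub _ _).trans ?_
  rw [abs_mul, abs_of_nonneg (measureReal_nonneg (μ := μ) (s := A'))]
  have b3 : μ.real A' * |μ.real B - h 0| ≤ 1 * |μ.real B - h 0| :=
    mul_le_mul_of_nonneg_right measureReal_le_one (abs_nonneg _)
  linarith

theorem exists_alphaCoef_le_geometric (H : StableAutoregression μ T η y)
    (hy : Integrable (fun ω => ‖y 0 ω‖) μ) :
    ∃ K ρ : ℝ, 0 ≤ K ∧ 0 ≤ ρ ∧ ρ < 1 ∧ ∀ k, alphaCoef μ y k ≤ K * ρ ^ k := by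
  obtain ⟨K, ρ, h0, h1, h⟩ := H.exists_abs_sub_le_geometric hy
  -- The sign of `K` comes from the bound at `k = 0`, where `ρ ^ 0 = 1`.
  have hK : 0 ≤ K := by
    simpa using (abs_nonneg _).trans (h 0 ∅ ∅ (@MeasurableSet.empty Ω (sigmaGen y (Set.Iic 0)))
        (@MeasurableSet.empty Ω (sigmaGen y (Set.Ici ((0 : ℕ) : ℤ)))))
  refine ⟨K, ρ, hK, h0, h1, fun k => Real.sSup_le ?_ (by positivity)⟩
  rintro r ⟨A, B, hA, hB, rfl⟩
  exact h k A B hA hB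

theorem tendsto_alphaCoef (H : StableAutoregression μ T η y)
    (hy : Integrable (fun ω => ‖y 0 ω‖) μ) : Tendsto (alphaCoef μ y) atTop (𝓝 0) := by
  obtain ⟨K, ρ, hK, h0, h1, h⟩ := H.exists_alphaCoef_le_geometric hy
  refine squeeze_zero alphaCoef_nonneg h ?_
  simpa using (tendsto_pow_atTop_nhds_zero_of_lt_one h0 h1).const_mul K

theorem summable_alphaCoef_rpow (H : StableAutoregression μ T η y)
    (hy : Integrable (fun ω => ‖y 0 ω‖) μ) {r : ℝ} (hr : 0 < r) :
    Summable fun k : ℕ => alphaCoef μ y (k + 1) ^ r := by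
  obtain ⟨K, ρ, hK, h0, h1, h⟩ := H.exists_alphaCoef_le_geometric hy
  have hs : Summable fun k : ℕ => K ^ r * (ρ ^ r) ^ (k + 1) :=
    ((summable_nat_add_iff 1).2 (summable_geometric_of_lt_one (Real.rpow_nonneg h0 r)
      (Real.rpow_lt_one h0 h1 hr))).mul_left _
  refine Summable.of_nonneg_of_le (fun k => Real.rpow_nonneg (alphaCoef_nonneg _) _)
    (fun k => ?_) hs
  calc alphaCoef μ y (k + 1) ^ r ≤ (K * ρ ^ (k + 1)) ^ r :=
        Real.rpow_le_rpow (alphaCoef_nonneg _) (h _) hr.le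
    _ = K ^ r * (ρ ^ r) ^ (k + 1) := by
        rw [Real.mul_rpow hK (by positivity), ← Real.rpow_natCast ρ, ← Real.rpow_natCast (ρ ^ r),
          ← Real.rpow_mul h0, ← Real.rpow_mul h0, mul_comm r]

end StableAutoregression

/-! ### Uniformly bounded row and column sums. -/

namespace BoundedRowColSums

variable {G H : ∀ p : ℕ, Matrix (Fin p) (Fin p) ℝ}

theorem exists_nonneg (h : BoundedRowColSums H) : ∃ C : ℝ, 0 ≤ C ∧
    ∀ p : ℕ, (∀ i, ∑ j, |H p i j| ≤ C) ∧ (∀ j, ∑ i, |H p i j| ≤ C) := by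
  obtain ⟨C, hC⟩ := h
  -- Dimension `1` is used because dimension `0` has no rows and says nothing about the sign of `C`.
  exact ⟨C, (Finset.sum_nonneg fun _ _ => abs_nonneg _).trans ((hC 1).1 0), hC⟩

theorem transpose (h : BoundedRowColSums H) : BoundedRowColSums fun p => (H p)ᵀ := by
  obtain ⟨C, hC⟩ := h
  exact ⟨C, fun p => ⟨(hC p).2, (hC p).1⟩⟩

theorem of_abs_le (h : BoundedRowColSums H) (hGH : ∀ p i j, |G p i j| ≤ |H p i j|) :
    BoundedRowColSums G := by
  obtain ⟨C, hC⟩ := h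
  exact ⟨C, fun p => ⟨fun i => (Finset.sum_le_sum fun j _ => hGH p i j).trans ((hC p).1 i),
    fun j => (Finset.sum_le_sum fun i _ => hGH p i j).trans ((hC p).2 j)⟩⟩

theorem abs (h : BoundedRowColSums H) :
    BoundedRowColSums fun p => Matrix.of fun i j => |H p i j| :=
  h.of_abs_le fun _ _ _ => (abs_abs _).le

theorem smul (h : BoundedRowColSums H) (c : ℝ) : BoundedRowColSums fun p => c • H p := by
  obtain ⟨C, hC⟩ := h
  refine ⟨|c| * C, fun p => ⟨fun i => ?_, fun j => ?_⟩⟩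
  · simp only [Matrix.smul_apply, smul_eq_mul, abs_mul, ← Finset.mul_sum]
    exact mul_le_mul_of_nonneg_left ((hC p).1 i) (abs_nonneg c)
  · simp only [Matrix.smul_apply, smul_eq_mul, abs_mul, ← Finset.mul_sum]
    exact mul_le_mul_of_nonneg_left ((hC p).2 j) (abs_nonneg c)

theorem _root_.sum_abs_mul_row_le {p : ℕ} {A B : Matrix (Fin p) (Fin p) ℝ} {a b : ℝ} (hb0 : 0 ≤ b)
    (hA : ∀ i, ∑ j, |A i j| ≤ a) (hB : ∀ i, ∑ j, |B i j| ≤ b) (i : Fin p) :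
    ∑ j, |(A * B) i j| ≤ a * b := by
  calc ∑ j, |(A * B) i j| ≤ ∑ j, ∑ m, |A i m| * |B m j| := by
        refine Finset.sum_le_sum fun j _ => ?_
        rw [Matrix.mul_apply]
        refine (Finset.abs_sum_le_sum_abs _ _).trans (le_of_eq ?_)
        simp only [abs_mul]
    _ = ∑ m, |A i m| * ∑ j, |B m j| := by
        rw [Finset.sum_comm]
        simp only [Finset.mul_sum]
    _ ≤ ∑ m, |A i m| * b := by gcongr with m; exact hB m
    _ = (∑ m, |A i m|) * b := (Finset.sum_mul _ _ _).symm
    _ ≤ a * b := by gcongr; exact hA i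

theorem mul (hG : BoundedRowColSums G) (hH : BoundedRowColSums H) :
    BoundedRowColSums fun p => G p * H p := by
  obtain ⟨a, ha0, ha⟩ := hG.exists_nonneg
  obtain ⟨b, hb0, hb⟩ := hH.exists_nonneg
  refine ⟨a * b, fun p => ⟨sum_abs_mul_row_le hb0 (ha p).1 (hb p).1, fun j => ?_⟩⟩
  have := sum_abs_mul_row_le (A := (H p)ᵀ) (B := (G p)ᵀ) ha0 (hb p).2 (ha p).2 j
  rw [← Matrix.transpose_mul] at this
  rw [mul_comm a b]
  exact this

end BoundedRowColSums

/-- Solutions of a matrix Lyapunov equation with absolutely summable powers are dominated entrywise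
by the corresponding product of absolute values. -/
theorem abs_le_of_lyapunov {p : ℕ} {A X Γ : Matrix (Fin p) (Fin p) ℝ}
    (hs : ∀ i j, Summable fun n : ℕ => |(A ^ n) i j|) (hX : X = A * X * Aᵀ + Γ) (i k : Fin p) :
    |X i k| ≤ ((Matrix.of fun i j => ∑' n : ℕ, |(A ^ n) i j|) * (Matrix.of fun i j => |Γ i j|) *
      (Matrix.of fun i j => ∑' n : ℕ, |(A ^ n) i j|)ᵀ) i k := by
  have hiter : ∀ n : ℕ, X = A ^ n * X * (A ^ n)ᵀ
      + ∑ j ∈ Finset.range n, A ^ j * Γ * (A ^ j)ᵀ := by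
    intro n
    induction n with
    | zero => simp
    | succ n ih =>
      rw [Finset.sum_range_succ, add_comm (∑ j ∈ _, _), ← add_assoc]
      refine ih.trans ?_
      congr 1
      conv_lhs => rw [hX]
      rw [pow_succ, Matrix.transpose_mul]
      simp only [Matrix.mul_add, Matrix.add_mul, Matrix.mul_assoc]
  have hent : ∀ (P Q R : Matrix (Fin p) (Fin p) ℝ), (P * Q * Rᵀ) i k
      = ∑ m, ∑ l, P i l * Q l m * R k m := fun P Q R => by
    simp only [Matrix.mul_apply, Matrix.transpose_apply, Finset.sum_mul]
  -- Summability of the entries of `A ^ n` makes the remainder of the iterated equation vanish.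
  have hlim : Tendsto (fun n : ℕ => (A ^ n * X * (A ^ n)ᵀ) i k) atTop (𝓝 0) := by
    simp only [hent]
    have h0 : ∀ i j, Tendsto (fun n : ℕ => (A ^ n) i j) atTop (𝓝 0) := fun i j =>
      (tendsto_zero_iff_abs_tendsto_zero _).2 (hs i j).tendsto_atTop_zero
    have : Tendsto (fun n : ℕ => ∑ m, ∑ l, (A ^ n) i l * X l m * (A ^ n) k m) atTop
        (𝓝 (∑ m : Fin p, ∑ l : Fin p, 0 * X l m * 0)) :=
      tendsto_finsetSum _ fun m _ => tendsto_finsetSum _ fun l _ =>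
        ((h0 i l).mul_const _).mul (h0 k m)
    simpa using this
  have hbound : ∀ n : ℕ, |X i k| ≤ |(A ^ n * X * (A ^ n)ᵀ) i k| +
      ((Matrix.of fun i j => ∑' n : ℕ, |(A ^ n) i j|) * (Matrix.of fun i j => |Γ i j|) *
        (Matrix.of fun i j => ∑' n : ℕ, |(A ^ n) i j|)ᵀ) i k := by
    intro n
    have h1 := congrFun (congrFun (hiter n) i) k
    rw [Matrix.add_apply] at h1
    rw [h1]
    refine (abs_add_le _ _).trans (add_le_add le_rfl ?_)
    rw [Matrix.sum_apply]
    refine (Finset.abs_sum_le_sum_abs _ _).trans ?_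
    -- The right factor `|A ^ j|` is enlarged to the whole series, so that the sum over `j` falls on
    -- the left factor alone.
    calc ∑ j ∈ Finset.range n, |(A ^ j * Γ * (A ^ j)ᵀ) i k|
        ≤ ∑ j ∈ Finset.range n, ∑ m, ∑ l, |(A ^ j) i l| * |Γ l m| * ∑' n : ℕ, |(A ^ n) k m| := by
          refine Finset.sum_le_sum fun j _ => ?_
          rw [hent]
          refine (Finset.abs_sum_le_sum_abs _ _).trans (Finset.sum_le_sum fun m _ => ?_)
          refine (Finset.abs_sum_le_sum_abs _ _).trans (Finset.sum_le_sum fun l _ => ?_)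
          rw [abs_mul, abs_mul]
          exact mul_le_mul_of_nonneg_left ((hs k m).le_tsum j fun _ _ => abs_nonneg _)
            (by positivity)
      _ = ∑ m, ∑ l, (∑ j ∈ Finset.range n, |(A ^ j) i l|) * |Γ l m|
            * ∑' n : ℕ, |(A ^ n) k m| := by
          rw [Finset.sum_comm]
          refine Finset.sum_congr rfl fun m _ => ?_
          rw [Finset.sum_comm]
          simp only [Finset.sum_mul]
      _ ≤ _ := by
          rw [hent]
          refine Finset.sum_le_sum fun m _ => Finset.sum_le_sum fun l _ => ?_
          refine mul_le_mul_of_nonneg_right (mul_le_mul_of_nonneg_right ?_ (abs_nonneg _))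
            (tsum_nonneg fun _ => abs_nonneg _)
          exact (hs i l).sum_le_tsum _ fun _ _ => abs_nonneg _
  refine ge_of_tendsto' (x := atTop) ?_ hbound
  simpa using hlim.abs.add_const (((Matrix.of fun i j => ∑' n : ℕ, |(A ^ n) i j|) *
    (Matrix.of fun i j => |Γ i j|) * (Matrix.of fun i j => ∑' n : ℕ, |(A ^ n) i j|)ᵀ) i k)

/-! ### Algebra of cross-covariance matrices. -/

section Covariance

variable {p : ℕ} {μ : Measure Ω} {X Y Z : Ω → Fin p → ℝ}

/-- The cross-covariance matrix of two random vectors. -/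
noncomputable def covMatrix (μ : Measure Ω) (X Y : Ω → Fin p → ℝ) : Matrix (Fin p) (Fin p) ℝ :=
  Matrix.of fun i j => cov[fun ω => X ω i, fun ω => Y ω j; μ]

theorem covMatrix_congr {X' Y' : Ω → Fin p → ℝ} (hX : X =ᵐ[μ] X') (hY : Y =ᵐ[μ] Y') :
    covMatrix μ X Y = covMatrix μ X' Y' := by
  ext i j
  have h1 : (fun ω => X ω i) =ᵐ[μ] fun ω => X' ω i := hX.mono fun ω h => congrFun h i
  have h2 : (fun ω => Y ω j) =ᵐ[μ] fun ω => Y' ω j := hY.mono fun ω h => congrFun h j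
  simp only [covMatrix, Matrix.of_apply, covariance]
  rw [integral_congr_ae h1, integral_congr_ae h2]
  refine integral_congr_ae ?_
  filter_upwards [h1, h2] with ω e1 e2
  rw [e1, e2]

theorem covMatrix_transpose : (covMatrix μ X Y)ᵀ = covMatrix μ Y X := by
  ext i j
  exact covariance_comm _ _

theorem covMatrix_eq_of_identDistrib (h : IdentDistrib X Y μ μ) :
    covMatrix μ X X = covMatrix μ Y Y := by
  ext i j
  have hm : ∀ i : Fin p, ∀ κ : Measure (Fin p → ℝ), AEStronglyMeasurable (fun x => x i) κ :=
    fun i κ => (measurable_pi_apply i).aestronglyMeasurable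
  simp only [covMatrix, Matrix.of_apply]
  rw [← covariance_map_fun (hm i _) (hm j _) h.aemeasurable_fst,
    ← covariance_map_fun (hm i _) (hm j _) h.aemeasurable_snd, h.map_eq]

theorem memLp_mulVec {q : ENNReal} (B : Matrix (Fin p) (Fin p) ℝ)
    (hX : ∀ i, MemLp (fun ω => X ω i) q μ) (i : Fin p) :
    MemLp (fun ω => (B *ᵥ X ω) i) q μ := by
  simp only [Matrix.mulVec, dotProduct]
  exact memLp_finsetSum _ fun j _ => (hX j).const_mul _

theorem covMatrix_eq_zero_of_indepFun (h : IndepFun X Y μ)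
    (hX : ∀ i, MemLp (fun ω => X ω i) 2 μ) (hY : ∀ i, MemLp (fun ω => Y ω i) 2 μ) :
    covMatrix μ X Y = 0 := by
  ext i j
  exact (h.comp (measurable_pi_apply i) (measurable_pi_apply j)).covariance_eq_zero (hX i) (hY j)

variable [IsFiniteMeasure μ]

theorem covMatrix_mulVec_left (B : Matrix (Fin p) (Fin p) ℝ)
    (hX : ∀ i, MemLp (fun ω => X ω i) 2 μ) (hY : ∀ i, MemLp (fun ω => Y ω i) 2 μ) :
    covMatrix μ (fun ω => B *ᵥ X ω) Y = B * covMatrix μ X Y := by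
  ext i j
  simp only [covMatrix, Matrix.of_apply, Matrix.mul_apply, Matrix.mulVec, dotProduct]
  rw [covariance_fun_sum_left (fun k => (hX k).const_mul _) (hY j)]
  simp only [covariance_const_mul_left]

theorem covMatrix_mulVec_right (B : Matrix (Fin p) (Fin p) ℝ)
    (hX : ∀ i, MemLp (fun ω => X ω i) 2 μ) (hY : ∀ i, MemLp (fun ω => Y ω i) 2 μ) :
    covMatrix μ X (fun ω => B *ᵥ Y ω) = covMatrix μ X Y * Bᵀ := by
  rw [← covMatrix_transpose, covMatrix_mulVec_left B hY hX, Matrix.transpose_mul,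
    covMatrix_transpose]

theorem covMatrix_add_left (hX : ∀ i, MemLp (fun ω => X ω i) 2 μ)
    (hY : ∀ i, MemLp (fun ω => Y ω i) 2 μ) (hZ : ∀ i, MemLp (fun ω => Z ω i) 2 μ) :
    covMatrix μ (fun ω => X ω + Y ω) Z = covMatrix μ X Z + covMatrix μ Y Z := by
  ext i j
  exact covariance_add_left (hX i) (hY i) (hZ j)

theorem covMatrix_add_right (hX : ∀ i, MemLp (fun ω => X ω i) 2 μ)
    (hY : ∀ i, MemLp (fun ω => Y ω i) 2 μ) (hZ : ∀ i, MemLp (fun ω => Z ω i) 2 μ) :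
    covMatrix μ X (fun ω => Y ω + Z ω) = covMatrix μ X Y + covMatrix μ X Z := by
  ext i j
  exact covariance_add_right (hX i) (hY j) (hZ j)

end Covariance

/-! ### Moments of linear forms. -/

section LinearForms

variable {p : ℕ} {μ : Measure Ω}

theorem eLpNorm_sum_mul_le {ι : Type*} (s : Finset ι) {q R : ENNReal} (hq : 1 ≤ q) (c : ι → ℝ)
    {X : ι → Ω → ℝ} (hX : ∀ i ∈ s, AEStronglyMeasurable (X i) μ)
    (hR : ∀ i ∈ s, eLpNorm (X i) q μ ≤ R) :
    eLpNorm (fun ω => ∑ i ∈ s, c i * X i ω) q μ ≤ ENNReal.ofReal (∑ i ∈ s, |c i|) * R := by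
  have h1 : (fun ω => ∑ i ∈ s, c i * X i ω) = ∑ i ∈ s, c i • X i := by
    ext ω
    simp [Finset.sum_apply]
  rw [h1, ENNReal.ofReal_sum_of_nonneg fun _ _ => abs_nonneg _, Finset.sum_mul]
  refine (eLpNorm_sum_le (fun i hi => (hX i hi).const_smul _) hq).trans ?_
  refine Finset.sum_le_sum fun i hi => ?_
  rw [eLpNorm_const_smul, ← Real.enorm_eq_ofReal_abs]
  gcongr
  exact hR i hi

theorem lintegral_rpow_eq_eLpNorm_pow (X : Ω → ℝ) :
    ∫⁻ ω, ‖X ω‖ₑ ^ ((4 : ℝ) + 4) ∂μ = eLpNorm X 8 μ ^ (8 : ℝ) := by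
  rw [eLpNorm_eq_lintegral_rpow_enorm_toReal (by norm_num) (by norm_num), ← ENNReal.rpow_mul]
  norm_num

/-- Linear forms with uniformly bounded row sums have uniformly bounded moments. -/
theorem uniformMoment_of_boundedRowColSums {H : ∀ p : ℕ, Matrix (Fin p) (Fin p) ℝ}
    (hH : BoundedRowColSums H) {y : ∀ p : ℕ, ℤ → Ω → Fin p → ℝ}
    (hy : ∀ p t, Measurable (y p t)) {R : ENNReal} (hR : R ≠ ⊤)
    (hyR : ∀ p t i, eLpNorm (fun ω => y p t ω i) 8 μ ≤ R) :
    UniformMoment μ (4 + 4) fun p i t ω => H p i ⬝ᵥ y p t ω := by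
  obtain ⟨C, hC⟩ := hH
  have hfin : (ENNReal.ofReal C * R) ^ (8 : ℝ) ≠ ⊤ :=
    ENNReal.rpow_ne_top_of_nonneg (by norm_num) (ENNReal.mul_ne_top ENNReal.ofReal_ne_top hR)
  refine ⟨((ENNReal.ofReal C * R) ^ (8 : ℝ)).toReal, fun p i t => ?_⟩
  rw [ENNReal.ofReal_toReal hfin, lintegral_rpow_eq_eLpNorm_pow]
  refine ENNReal.rpow_le_rpow ?_ (by norm_num)
  refine (eLpNorm_sum_mul_le Finset.univ (by norm_num) (H p i) (X := fun j ω => y p t ω j)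
    (fun j _ => ((measurable_pi_apply j).comp (hy p t)).aestronglyMeasurable)
    fun j _ => hyR p t j).trans ?_
  gcongr
  exact (hC p).1 i

end LinearForms

/-! ### The error vectors: independence, density, covariance. -/

theorem pi_absolutelyContinuous : ∀ {n : ℕ} (κ ν : Fin n → Measure ℝ) [∀ i, SigmaFinite (κ i)]
    [∀ i, SigmaFinite (ν i)], (∀ i, κ i ≪ ν i) → Measure.pi κ ≪ Measure.pi ν := by
  intro n
  induction n with
  | zero =>
    intro κ ν _ _ _
    rw [Measure.pi_of_empty κ, Measure.pi_of_empty ν]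
  | succ n ih =>
    intro κ ν _ _ h
    rw [← (measurePreserving_piFinSuccAbove κ 0).symm.map_eq,
      ← (measurePreserving_piFinSuccAbove ν 0).symm.map_eq]
    exact ((h 0).prod (ih _ _ fun j => h _)).map (MeasurableEquiv.measurable _)

namespace ConditionB1

variable {μ : Measure Ω} {ε : ℕ → ℤ → Ω → ℝ} {σ₀ : ℝ}

theorem eLpNorm_eq (h : ConditionB1 μ ε σ₀ 4) (i : ℕ) (t : ℤ) :
    eLpNorm (ε i t) 8 μ = eLpNorm (ε 0 0) 8 μ :=
  (h.identDistrib i t 0 0).eLpNorm_eq 8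

theorem eLpNorm_ne_top (h : ConditionB1 μ ε σ₀ 4) : eLpNorm (ε 0 0) 8 μ ≠ ⊤ := by
  intro htop
  have h1 := h.moment 0 0
  rw [lintegral_rpow_eq_eLpNorm_pow, htop] at h1
  norm_num at h1

theorem memLp (h : ConditionB1 μ ε σ₀ 4) (i : ℕ) (t : ℤ) : MemLp (ε i t) 8 μ :=
  ⟨(h.measurable i t).aestronglyMeasurable, by
    rw [h.eLpNorm_eq]; exact h.eLpNorm_ne_top.lt_top⟩

theorem measurable_errorVec (h : ConditionB1 μ ε σ₀ 4) (p : ℕ) (t : ℤ) :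
    Measurable (errorVec ε p t) :=
  measurable_pi_lambda _ fun i => h.measurable i t

theorem iIndepFun_errorVec_apply (h : ConditionB1 μ ε σ₀ 4) (p : ℕ) (t : ℤ) :
    iIndepFun (fun (i : Fin p) => ε i t) μ :=
  h.indep.precomp (g := fun i : Fin p => ((i : ℕ), t)) fun i j hij => by
    simpa [Fin.ext_iff] using hij

variable [IsProbabilityMeasure μ]

/-- Independence means that the joint law is a product; currying regroups the product over pairs
(time, location) into a product over times of products over locations. -/
theorem iIndepFun_errorVec (h : ConditionB1 μ ε σ₀ 4) (p : ℕ) :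
    iIndepFun (fun t => errorVec ε p t) μ := by
  have : ∀ (t : ℤ) (i : Fin p), IsProbabilityMeasure (μ.map (ε i t)) := fun t i =>
    Measure.isProbabilityMeasure_map (h.measurable i t).aemeasurable
  have hind : iIndepFun (fun q : ℤ × Fin p => ε q.2 q.1) μ :=
    h.indep.precomp (g := fun q : ℤ × Fin p => ((q.2 : ℕ), q.1)) fun q r hqr => by
      simpa [Prod.ext_iff, Fin.ext_iff, and_comm] using hqr
  have hm : Measurable fun ω (q : ℤ × Fin p) => ε q.2 q.1 ω :=
    measurable_pi_lambda _ fun q => h.measurable _ _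
  rw [iIndepFun_iff_map_fun_eq_infinitePi_map fun t => h.measurable_errorVec p t]
  have h1 : (fun ω t => errorVec ε p t ω) =
      MeasurableEquiv.curry ℤ (Fin p) ℝ ∘ fun ω (q : ℤ × Fin p) => ε q.2 q.1 ω := rfl
  rw [h1, ← Measure.map_map (MeasurableEquiv.measurable _) hm,
    hind.map_fun_eq_infinitePi_map fun q => h.measurable _ _,
    Measure.infinitePi_map_curry fun (t : ℤ) (i : Fin p) => μ.map (ε i t)]
  congr 1
  funext t
  exact ((h.iIndepFun_errorVec_apply p t).map_fun_eq_infinitePi_map fun i => h.measurable _ _).symm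

theorem map_errorVec_absolutelyContinuous (h : ConditionB1 μ ε σ₀ 4) (p : ℕ) (t : ℤ) :
    μ.map (errorVec ε p t) ≪ volume := by
  have : ∀ i : Fin p, IsProbabilityMeasure (μ.map (ε i t)) := fun i =>
    Measure.isProbabilityMeasure_map (h.measurable i t).aemeasurable
  have h1 : μ.map (errorVec ε p t) = Measure.pi fun i : Fin p => μ.map (ε i t) :=
    (h.iIndepFun_errorVec_apply p t).map_fun_eq_pi_map fun i => (h.measurable i t).aemeasurable
  rw [h1, volume_pi]
  exact pi_absolutelyContinuous _ _ fun i => (h.density i t).absolutelyContinuous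

theorem covMatrix_errorVec (h : ConditionB1 μ ε σ₀ 4) (p : ℕ) (t : ℤ) :
    covMatrix μ (errorVec ε p t) (errorVec ε p t) = σ₀ ^ 2 • (1 : Matrix (Fin p) (Fin p) ℝ) := by
  have hm : ∀ i t, MemLp (ε i t) 2 μ := fun i t => (h.memLp i t).mono_exponent (by norm_num)
  ext i j
  rw [Matrix.smul_apply, Matrix.one_apply]
  by_cases hij : i = j
  · subst hij
    simp only [covMatrix, Matrix.of_apply, errorVec, if_true, smul_eq_mul, mul_one]
    rw [← h.variance_eq i t]
    exact covariance_self (h.measurable i t).aemeasurable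
  · rw [if_neg hij, smul_zero]
    exact ((h.iIndepFun_errorVec_apply p t).indepFun hij).covariance_eq_zero (hm i t) (hm j t)

end ConditionB1

/-! ### The reduced form of the spatial model. -/

namespace SpatialModel

variable {p : ℕ}

/-- The operator of the reduced form `y_t = A y_{t-1} + S⁻¹ ε_t`. -/
noncomputable def transition (M : SpatialModel p) : (Fin p → ℝ) →L[ℝ] (Fin p → ℝ) :=
  (Matrix.mulVecLin M.A).toContinuousLinearMap

theorem transition_pow_apply (M : SpatialModel p) (n : ℕ) (v : Fin p → ℝ) :
    (M.transition ^ n) v = (M.A ^ n) *ᵥ v := by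
  induction n generalizing v with
  | zero => simp
  | succ n ih =>
    rw [pow_succ, mul_apply_eq_comp, ih, pow_succ, ← Matrix.mulVec_mulVec]
    rfl

/-- For the supremum norm, the operator norm is at most the sum of the absolute values of all
entries. -/
theorem summable_norm_transition_pow (M : SpatialModel p)
    (h : ∀ i j, Summable fun n : ℕ => |(M.A ^ n) i j|) :
    Summable fun n : ℕ => ‖M.transition ^ n‖ := by
  have hs : Summable fun n : ℕ => ∑ i, ∑ j, |(M.A ^ n) i j| :=
    summable_sum fun i _ => summable_sum fun j _ => h i j
  refine Summable.of_nonneg_of_le (fun n => norm_nonneg _) (fun n => ?_) hs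
  refine ContinuousLinearMap.opNorm_le_bound _ (by positivity) fun v => ?_
  rw [transition_pow_apply, pi_norm_le_iff_of_nonneg (by positivity)]
  intro i
  calc ‖((M.A ^ n) *ᵥ v) i‖ ≤ ∑ j, |(M.A ^ n) i j| * ‖v‖ := by
        rw [Matrix.mulVec, dotProduct]
        refine (norm_sum_le _ _).trans (Finset.sum_le_sum fun j _ => ?_)
        rw [norm_mul, Real.norm_eq_abs]
        exact mul_le_mul_of_nonneg_left (norm_le_pi_norm v j) (abs_nonneg _)
    _ = (∑ j, |(M.A ^ n) i j|) * ‖v‖ := (Finset.sum_mul _ _ _).symm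
    _ ≤ (∑ i, ∑ j, |(M.A ^ n) i j|) * ‖v‖ := by
        refine mul_le_mul_of_nonneg_right ?_ (norm_nonneg v)
        exact Finset.single_le_sum (f := fun i => ∑ j, |(M.A ^ n) i j|)
          (fun i _ => Finset.sum_nonneg fun j _ => abs_nonneg _) (Finset.mem_univ i)

/-- The innovation `S⁻¹ ε_t` of the reduced form. -/
noncomputable def innovation (M : SpatialModel p) (ε : ℕ → ℤ → Ω → ℝ) (t : ℤ) (ω : Ω) : Fin p → ℝ :=
  M.S⁻¹ *ᵥ errorVec ε p t ω

theorem reduced_form (M : SpatialModel p) (hS : IsUnit M.S) {x x' e : Fin p → ℝ}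
    (h : x = Matrix.diagonal M.lam0 *ᵥ (M.W *ᵥ x) + Matrix.diagonal M.lam1 *ᵥ x'
      + Matrix.diagonal M.lam2 *ᵥ (M.W *ᵥ x') + e) :
    x = M.A *ᵥ x' + M.S⁻¹ *ᵥ e := by
  have hdet : IsUnit M.S.det := (Matrix.isUnit_iff_isUnit_det _).1 hS
  have h1 : M.S *ᵥ x = (Matrix.diagonal M.lam1 + Matrix.diagonal M.lam2 * M.W) *ᵥ x' + e := by
    rw [S, Matrix.sub_mulVec, Matrix.one_mulVec, Matrix.add_mulVec, ← Matrix.mulVec_mulVec,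
      ← Matrix.mulVec_mulVec]
    nth_rewrite 1 [h]
    abel
  calc x = M.S⁻¹ *ᵥ (M.S *ᵥ x) := by
        rw [Matrix.mulVec_mulVec, Matrix.nonsing_inv_mul _ hdet, Matrix.one_mulVec]
    _ = _ := by
        rw [h1, Matrix.mulVec_add, Matrix.mulVec_mulVec]
        rfl

variable {μ : Measure Ω} {M : SpatialModel p} {ε : ℕ → ℤ → Ω → ℝ}
  {σ₀ : ℝ} {y : ℤ → Ω → Fin p → ℝ}

theorem memLp_innovation (hB1 : ConditionB1 μ ε σ₀ 4) (t : ℤ) (i : Fin p) :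
    MemLp (fun ω => M.innovation ε t ω i) 8 μ :=
  memLp_mulVec _ (fun j => hB1.memLp j t) i

variable [IsProbabilityMeasure μ]

theorem stableAutoregression (hB1 : ConditionB1 μ ε σ₀ 4) (hS : IsUnit M.S)
    (hsum : ∀ i j, Summable fun n : ℕ => |(M.A ^ n) i j|) (hy : ∀ t, Measurable (y t))
    (hmodel : SolvesModel μ M (errorVec ε p) y) (hbdd : BoundedInProbability μ y) :
    StableAutoregression μ M.transition (M.innovation ε) y := by
  have hL : Measurable fun x : Fin p → ℝ => M.S⁻¹ *ᵥ x :=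
    (Matrix.mulVecLin M.S⁻¹).toContinuousLinearMap.measurable
  refine ⟨fun t => hL.comp (hB1.measurable_errorVec p t), ?_, fun s t => ?_, ?_, ?_,
    M.summable_norm_transition_pow hsum, hy, fun t => ?_, hbdd⟩
  · exact (hB1.iIndepFun_errorVec p).comp (fun _ x => M.S⁻¹ *ᵥ x) fun _ => hL
  · exact (IdentDistrib.pi (fun i : Fin p => hB1.identDistrib i s i t)
      (hB1.iIndepFun_errorVec_apply p s) (hB1.iIndepFun_errorVec_apply p t)).comp hL
  · have hi : Integrable (M.innovation ε 0) μ := Integrable.of_eval fun i =>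
      (memLp_innovation hB1 0 i).integrable (by norm_num)
    exact hi.2
  -- An invertible linear map sends Lebesgue measure to a multiple of itself, so `S⁻¹ ε` inherits
  -- absolute continuity from `ε`.
  · have hdet : IsUnit M.S.det := (Matrix.isUnit_iff_isUnit_det _).1 hS
    have hdet' : LinearMap.det (Matrix.mulVecLin M.S⁻¹) ≠ 0 := by
      rw [← Matrix.toLin'_apply', LinearMap.det_toLin']
      exact ((Matrix.isUnit_nonsing_inv_det_iff).2 hdet).ne_zero
    have h1 : μ.map (M.innovation ε 0) = (μ.map (errorVec ε p 0)).map (Matrix.mulVecLin M.S⁻¹) :=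
      (Measure.map_map hL (hB1.measurable_errorVec p 0)).symm
    rw [h1]
    refine ((hB1.map_errorVec_absolutelyContinuous p 0).map hL).trans ?_
    have h2 := Measure.map_linearMap_addHaar_eq_smul_addHaar
      (volume : Measure (Fin p → ℝ)) hdet'
    have h3 : (volume : Measure (Fin p → ℝ)).map (fun x => M.S⁻¹ *ᵥ x) ≪ volume := by
      refine (Measure.absolutelyContinuous_of_eq h2).trans ?_
      exact Measure.smul_absolutelyContinuous
    exact h3
  · filter_upwards [hmodel t] with ω hω
    exact M.reduced_form hS hω

/-- Uniform moment bound for the components, by Minkowski's inequality for the moving average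
representation. -/
theorem eLpNorm_le (hB1 : ConditionB1 μ ε σ₀ 4)
    (H : StableAutoregression μ M.transition (M.innovation ε) y)
    (hsum : ∀ i j, Summable fun n : ℕ => |(M.A ^ n) i j|) {a s : ℝ} (hs0 : 0 ≤ s)
    (ha : ∀ i, ∑ j, |∑' n : ℕ, (|(M.A ^ n) i j|)| ≤ a) (hs : ∀ i, ∑ j, |M.S⁻¹ i j| ≤ s)
    (t : ℤ) (i : Fin p) :
    eLpNorm (fun ω => y t ω i) 8 μ ≤ ENNReal.ofReal (a * s) * eLpNorm (ε 0 0) 8 μ := by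
  have hlim : ∀ᵐ ω ∂μ, Tendsto (fun n : ℕ => ∑ q ∈ Finset.range n ×ˢ (Finset.univ : Finset (Fin p)),
      (M.A ^ q.1 * M.S⁻¹) i q.2 * ε q.2 (t - q.1) ω) atTop (𝓝 (y t ω i)) := by
    filter_upwards [H.ae_tendsto t] with ω hω
    have h1 := (tendsto_pi_nhds.1 hω) i
    refine h1.congr fun n => ?_
    rw [Finset.sum_apply, Finset.sum_product]
    refine Finset.sum_congr rfl fun j _ => ?_
    rw [transition_pow_apply, innovation, Matrix.mulVec_mulVec]
    rfl
  -- Fatou's lemma reduces the claim to the partial sums, for which the coefficient bound `a * s`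
  -- does not depend on `n`.
  refine (Lp.eLpNorm_lim_le_liminf_eLpNorm (fun n => ?_) _ hlim).trans ?_
  · exact (Finset.measurable_sum _ fun q _ =>
      (hB1.measurable _ _).const_mul _).aestronglyMeasurable
  refine liminf_le_of_le (by isBoundedDefault) fun b hb => ?_
  obtain ⟨n, hn⟩ := hb.exists
  refine hn.trans ((eLpNorm_sum_mul_le _ (by norm_num) _
    (X := fun q : ℕ × Fin p => ε q.2 (t - q.1))
    (fun q _ => (hB1.measurable _ _).aestronglyMeasurable)
    fun q _ => (hB1.eLpNorm_eq _ _).le).trans ?_)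
  gcongr
  rw [Finset.sum_product]
  calc ∑ j ∈ Finset.range n, ∑ l, |(M.A ^ j * M.S⁻¹) i l|
      ≤ ∑ j ∈ Finset.range n, ∑ l, ∑ m, |(M.A ^ j) i m| * |M.S⁻¹ m l| := by
        refine Finset.sum_le_sum fun j _ => Finset.sum_le_sum fun l _ => ?_
        rw [Matrix.mul_apply]
        refine (Finset.abs_sum_le_sum_abs _ _).trans (le_of_eq ?_)
        simp only [abs_mul]
    _ = ∑ m, (∑ j ∈ Finset.range n, |(M.A ^ j) i m|) * ∑ l, |M.S⁻¹ m l| := by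
        simp only [Finset.sum_mul]
        symm
        rw [Finset.sum_comm]
        refine Finset.sum_congr rfl fun j _ => ?_
        simp only [Finset.mul_sum]
        exact Finset.sum_comm
    _ ≤ ∑ m, |∑' n : ℕ, (|(M.A ^ n) i m|)| * s := by
        refine Finset.sum_le_sum fun m _ => mul_le_mul ?_ (hs m)
          (Finset.sum_nonneg fun _ _ => abs_nonneg _) (abs_nonneg _)
        exact ((hsum i m).sum_le_tsum _ fun _ _ => abs_nonneg _).trans (le_abs_self _)
    _ = (∑ m, |∑' n : ℕ, (|(M.A ^ n) i m|)|) * s := (Finset.sum_mul _ _ _).symm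
    _ ≤ a * s := by gcongr; exact ha i

end SpatialModel

/-! ### Second-order structure of the solution. -/

namespace StableAutoregression

variable {p : ℕ} {μ : Measure Ω} [IsProbabilityMeasure μ]
  {T : (Fin p → ℝ) →L[ℝ] (Fin p → ℝ)} {η y : ℤ → Ω → Fin p → ℝ}

theorem indepFun_prev (H : StableAutoregression μ T η y) (t : ℤ) :
    IndepFun (y (t - 1)) (η t) μ := by
  have h := (H.indepFun_past (k := t - 1) (MeasurableSet.univ) (Z := η t)
    (measurable_sigmaGen η (by simp))).comp measurable_snd measurable_id
  exact h.congr (H.ae_eq_causal _).symm (ae_eq_refl _)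

theorem covMatrix_stationary (H : StableAutoregression μ T η y) (t : ℤ) :
    covMatrix μ (y t) (y t) = autoCov μ y 0 := by
  refine covMatrix_eq_of_identDistrib ?_
  have h := (H.strictlyStationary t).comp
    (u := fun x : ℤ → Fin p → ℝ => x 0) (measurable_pi_apply 0)
  simp only [Function.comp_def, zero_add] at h
  exact h

end StableAutoregression

namespace SpatialModel

variable {p : ℕ} {μ : Measure Ω} [IsProbabilityMeasure μ] {M : SpatialModel p}
  {ε : ℕ → ℤ → Ω → ℝ} {σ₀ : ℝ} {y : ℤ → Ω → Fin p → ℝ}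

theorem covMatrix_past_errorVec (hB1 : ConditionB1 μ ε σ₀ 4) (hS : IsUnit M.S)
    (H : StableAutoregression μ M.transition (M.innovation ε) y)
    (hy : ∀ t i, MemLp (fun ω => y t ω i) 2 μ) (t : ℤ) :
    covMatrix μ (y (t - 1)) (errorVec ε p t) = 0 := by
  have hdet : IsUnit M.S.det := (Matrix.isUnit_iff_isUnit_det _).1 hS
  -- Independence of the past is known for the innovation `S⁻¹ ε_t`; multiplying by `S` transfers it
  -- to `ε_t`.
  have he : (fun ω => M.S *ᵥ M.innovation ε t ω) = errorVec ε p t := by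
    funext ω
    rw [innovation, Matrix.mulVec_mulVec, Matrix.mul_nonsing_inv _ hdet, Matrix.one_mulVec]
  have hη : ∀ i, MemLp (fun ω => M.innovation ε t ω i) 2 μ := fun i =>
    (memLp_innovation hB1 t i).mono_exponent (by norm_num)
  rw [← he, covMatrix_mulVec_right _ (hy _) hη,
    covMatrix_eq_zero_of_indepFun (H.indepFun_prev t) (hy _) hη, Matrix.zero_mul]

theorem covMatrix_innovation (hB1 : ConditionB1 μ ε σ₀ 4) (t : ℤ) :
    covMatrix μ (M.innovation ε t) (M.innovation ε t) = σ₀ ^ 2 • (M.S⁻¹ * (M.S⁻¹)ᵀ) := by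
  have he : ∀ i, MemLp (fun ω => errorVec ε p t ω i) 2 μ := fun i =>
    (hB1.memLp i t).mono_exponent (by norm_num)
  have h1 : M.innovation ε t = fun ω => M.S⁻¹ *ᵥ errorVec ε p t ω := rfl
  rw [h1, covMatrix_mulVec_left _ he (memLp_mulVec _ he), covMatrix_mulVec_right _ he he,
    hB1.covMatrix_errorVec]
  simp

theorem autoCov_one (hB1 : ConditionB1 μ ε σ₀ 4)
    (H : StableAutoregression μ M.transition (M.innovation ε) y)
    (hy : ∀ t i, MemLp (fun ω => y t ω i) 2 μ) :
    autoCov μ y 1 = M.A * autoCov μ y 0 := by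
  have hη : ∀ i, MemLp (fun ω => M.innovation ε 1 ω i) 2 μ := fun i =>
    (memLp_innovation hB1 1 i).mono_exponent (by norm_num)
  have hrec : y 1 =ᵐ[μ] fun ω => M.A *ᵥ y 0 ω + M.innovation ε 1 ω := H.recursion 1
  have h0 : covMatrix μ (M.innovation ε 1) (y 0) = 0 :=
    covMatrix_eq_zero_of_indepFun (H.indepFun_prev 1).symm hη (hy _)
  have h1 : autoCov μ y 1 = covMatrix μ (y 1) (y 0) := rfl
  have h2 : autoCov μ y 0 = covMatrix μ (y 0) (y 0) := rfl
  rw [h1, h2, covMatrix_congr hrec (ae_eq_refl _),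
    covMatrix_add_left (memLp_mulVec _ (hy 0)) hη (hy 0), h0, add_zero,
    covMatrix_mulVec_left _ (hy 0) (hy 0)]

/-- Stationarity lets `Σ₀` be computed at time `1`, where one step of the recursion expands it; the
cross terms vanish by independence of the innovation and `y 0`. -/
theorem autoCov_zero_lyapunov (hB1 : ConditionB1 μ ε σ₀ 4)
    (H : StableAutoregression μ M.transition (M.innovation ε) y)
    (hy : ∀ t i, MemLp (fun ω => y t ω i) 2 μ) :
    autoCov μ y 0 = M.A * autoCov μ y 0 * M.Aᵀ + σ₀ ^ 2 • (M.S⁻¹ * (M.S⁻¹)ᵀ) := by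
  have hη : ∀ i, MemLp (fun ω => M.innovation ε 1 ω i) 2 μ := fun i =>
    (memLp_innovation hB1 1 i).mono_exponent (by norm_num)
  have hAy : ∀ i, MemLp (fun ω => (M.A *ᵥ y 0 ω) i) 2 μ := memLp_mulVec _ (hy 0)
  have hrec : y 1 =ᵐ[μ] fun ω => M.A *ᵥ y 0 ω + M.innovation ε 1 ω := H.recursion 1
  have h0 : covMatrix μ (M.innovation ε 1) (y 0) = 0 :=
    covMatrix_eq_zero_of_indepFun (H.indepFun_prev 1).symm hη (hy _)
  have h0' : covMatrix μ (y 0) (M.innovation ε 1) = 0 :=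
    covMatrix_eq_zero_of_indepFun (H.indepFun_prev 1) (hy _) hη
  have h2 : autoCov μ y 0 = covMatrix μ (y 0) (y 0) := rfl
  have hX : ∀ i, MemLp (fun ω => (M.A *ᵥ y 0 ω + M.innovation ε 1 ω) i) 2 μ := fun i =>
    (hAy i).add (hη i)
  conv_lhs => rw [← H.covMatrix_stationary 1, covMatrix_congr hrec hrec]
  rw [covMatrix_add_left hAy hη hX, covMatrix_add_right hAy hAy hη,
    covMatrix_add_right hη hAy hη, covMatrix_mulVec_left _ (hy 0) hAy,
    covMatrix_mulVec_left _ (hy 0) hη, covMatrix_mulVec_right _ (hy 0) (hy 0),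
    covMatrix_mulVec_right _ hη (hy 0), h0, h0', covMatrix_innovation hB1, h2]
  simp [Matrix.mul_assoc]

end SpatialModel

end Autoregression

theorem lemma1 {Ω : Type*} [MeasurableSpace Ω] (μ : Measure Ω) [IsProbabilityMeasure μ]
    (M : ∀ p : ℕ, SpatialModel p) (ε : ℕ → ℤ → Ω → ℝ) (σ₀ : ℝ)
    (y : ∀ p : ℕ, ℤ → Ω → Fin p → ℝ)
    (hy_meas : ∀ p t, Measurable (y p t))
    (hy_model : ∀ p, SolvesModel μ (M p) (errorVec ε p) (y p))
    (hy_bdd : ∀ p, BoundedInProbability μ (y p))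
    (hA1 : ConditionA1 M)
    (hB1 : ConditionB1 μ ε σ₀ 4)
    (hB2 : ConditionB2 M)
    (hB3 : ConditionB3 M) :
    ConditionA2 μ M ε y 4 := by
  have H : ∀ p, StableAutoregression μ (M p).transition ((M p).innovation ε) (y p) := fun p =>
    SpatialModel.stableAutoregression hB1 (hA1.invertible p) (hB3.summable p) (hy_meas p)
      (hy_model p) (hy_bdd p)
  obtain ⟨a, ha0, ha⟩ := hB3.bounded.exists_nonneg
  obtain ⟨s, hs0, hs⟩ := hB2.inverse.exists_nonneg
  set R : ENNReal := ENNReal.ofReal (a * s) * eLpNorm (ε 0 0) 8 μ with hR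
  have hRtop : R ≠ ⊤ := ENNReal.mul_ne_top ENNReal.ofReal_ne_top hB1.eLpNorm_ne_top
  have hyR : ∀ p t i, eLpNorm (fun ω => y p t ω i) 8 μ ≤ R := fun p t i =>
    SpatialModel.eLpNorm_le hB1 (H p) (hB3.summable p) hs0 (ha p).1 (hs p).1 t i
  have hy8 : ∀ p t i, MemLp (fun ω => y p t ω i) 8 μ := fun p t i =>
    ⟨((measurable_pi_apply i).comp (hy_meas p t)).aestronglyMeasurable,
      (hyR p t i).trans_lt hRtop.lt_top⟩
  have hy2 : ∀ p t i, MemLp (fun ω => y p t ω i) 2 μ := fun p t i =>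
    (hy8 p t i).mono_exponent (by norm_num)
  have hyi : ∀ p, Integrable (fun ω => ‖y p 0 ω‖) μ := fun p =>
    (Integrable.of_eval fun i => (hy8 p 0 i).integrable (by norm_num)).norm
  -- `|A|` is the term of exponent `1` in the series `∑ |A^n|`.
  have hAb : BoundedRowColSums fun p => (M p).A := hB3.bounded.of_abs_le fun p i j => by
    have h1 := (hB3.summable p i j).le_tsum 1 fun _ _ => abs_nonneg _
    rw [pow_one] at h1
    exact h1.trans (le_abs_self _)
  have hS0 : BoundedRowColSums fun p => autoCov μ (y p) 0 := by
    have hΓ : BoundedRowColSums fun p => σ₀ ^ 2 • ((M p).S⁻¹ * ((M p).S⁻¹)ᵀ) :=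
      (hB2.inverse.mul hB2.inverse.transpose).smul _
    refine ((hB3.bounded.mul hΓ.abs).mul hB3.bounded.transpose).of_abs_le fun p i j => ?_
    exact (abs_le_of_lyapunov (hB3.summable p)
      (SpatialModel.autoCov_zero_lyapunov hB1 (H p) (hy2 p)) i j).trans (le_abs_self _)
  have hS1 : BoundedRowColSums fun p => autoCov μ (y p) 1 := by
    have : (fun p => autoCov μ (y p) 1) = fun p => (M p).A * autoCov μ (y p) 0 :=
      funext fun p => SpatialModel.autoCov_one hB1 (H p) (hy2 p)
    rw [this]
    exact hAb.mul hS0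
  have hW := hB2.weight
  -- Unit vectors are the rows of the identity, so the forms in `e_i` are treated exactly like those
  -- in `w_i`.
  have hI : BoundedRowColSums fun p => (1 : Matrix (Fin p) (Fin p) ℝ) :=
    ⟨1, fun p => ⟨fun i => by simp [Matrix.one_apply, apply_ite], fun i => by
      simp [Matrix.one_apply, apply_ite]⟩⟩
  have hsingle : ∀ (p : ℕ) (i : Fin p),
      (Pi.single i 1 : Fin p → ℝ) = (1 : Matrix (Fin p) (Fin p) ℝ) i := fun p i => by
    ext j
    simp [Matrix.one_apply, Pi.single_apply, eq_comm]
  have hmom : ∀ {G : ∀ p : ℕ, Matrix (Fin p) (Fin p) ℝ}, BoundedRowColSums G →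
      UniformMoment μ (4 + 4) fun p i t ω => G p i ⬝ᵥ y p t ω := fun hG =>
    uniformMoment_of_boundedRowColSums hG hy_meas hRtop hyR
  have hrow : ∀ {p : ℕ} (G K : Matrix (Fin p) (Fin p) ℝ) (i : Fin p) (v : Fin p → ℝ),
      G i ⬝ᵥ (K *ᵥ v) = (G * K) i ⬝ᵥ v := fun G K i v => by
    rw [Matrix.dotProduct_mulVec, Matrix.mul_apply_eq_vecMul]
  have hquad : ∀ {p : ℕ} (G K : Matrix (Fin p) (Fin p) ℝ) (i : Fin p),
      G i ⬝ᵥ (K *ᵥ G i) = (G * K * Gᵀ) i i := fun G K i => by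
    rw [hrow, Matrix.mul_apply]
    rfl
  have hdiag : ∀ {G : ∀ p : ℕ, Matrix (Fin p) (Fin p) ℝ}, BoundedRowColSums G →
      ∃ C : ℝ, ∀ (p : ℕ) (i : Fin p), |G p i i| ≤ C := fun {G} ⟨C, hC⟩ =>
    ⟨C, fun p i => (Finset.single_le_sum (f := fun j => |G p i j|) (fun _ _ => abs_nonneg _)
      (Finset.mem_univ i)).trans ((hC p).1 i)⟩
  refine
    { uncorrelated := fun p t i j => ?_
      gamma_pos := by norm_num
      stationary := fun p => (H p).strictlyStationary
      mixing := fun p => (H p).tendsto_alphaCoef (hyi p)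
      summable_alpha := fun p => (H p).summable_alphaCoef_rpow (hyi p) (by norm_num)
      moment_w_S0 := ?_
      moment_w_S1 := ?_
      moment_e_S0 := ?_
      moment_w := hmom hW
      moment_e := ?_
      diag_V := ?_ }
  · exact congrFun (congrFun (SpatialModel.covMatrix_past_errorVec hB1 (hA1.invertible p) (H p)
      (hy2 p) t) i) j
  · simp only [hrow]
    exact hmom (hW.mul hS0)
  · simp only [hrow]
    exact hmom (hW.mul hS1)
  · simp only [hsingle, hrow]
    exact hmom (hI.mul hS0)
  · simp only [hsingle]
    exact hmom hI
  -- Each diagonal element of `V_i` is a diagonal entry of some `G K Gᵀ` with `G` equal to `W` or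
  -- the identity, and is dominated by a row sum.
  · obtain ⟨C₀, h0⟩ := hdiag ((hW.mul (hS1.mul hS1.transpose)).mul hW.transpose)
    obtain ⟨C₁, h1⟩ := hdiag ((hI.mul (hS0.mul hS0)).mul hI.transpose)
    obtain ⟨C₂, h2⟩ := hdiag ((hW.mul (hS0.mul hS0)).mul hW.transpose)
    refine ⟨max C₀ (max C₁ C₂), fun p i k => ?_⟩
    fin_cases k
    · refine le_trans ?_ (le_max_left _ _)
      simpa [matV, hquad] using h0 p i
    · refine le_trans ?_ ((le_max_left _ _).trans (le_max_right _ _))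
      have := h1 p i
      rw [← hquad, ← hsingle] at this
      exact this
    · refine le_trans ?_ ((le_max_right _ _).trans (le_max_right _ _))
      simpa [matV, hquad] using h2 p i
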